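/- Let $n\ge 1$ and $0<p,q\le\infty$. Fix a smooth function $\eta:\mathbb{R}^n\to[0,1]$ with $\eta(\xi)=1$ for $|\xi|_\infty\le 1/2$ and $\eta(\xi)=0$ for $|\xi|_\infty\ge 3/4$, put $\sigma_k(\xi)=\eta(\xi-k)\big(\sum_{l\in\mathbb{Z}^n}\eta(\xi-l)\big)^{-1}$ and $\Box_k=\mathscr{F}^{-1}\sigma_k\mathscr{F}$ for $k\in\mathbb{Z}^n$, and let the modulation space $M^{p,q}(\mathbb{R}^n)$ consist of all tempered distributions $f$ with $$\|f\|_{M^{p,q}}=\Big(\sum_{k\in\mathbb{Z}^n}\|\Box_kf\|_{L^p}^q\Big)^{1/q}<\infty$$ (the supremum over $k$ if $q=\infty$). Let $\Phi:\mathbb{R}^n\to\mathbb{C}$ be a measurable function with $$\int_{B(0,1)}|y|^n|\Phi(y)|\,dy<\infty,\qquad \int_{B(0,1)^c}|\Phi(y)|\,dy<\infty,$$ and let $H_\Phi$ be the Hausdorff operator $$H_\Phi f(x)=\int_{\mathbb{R}^n}\Phi(y)\,f\!\left(\frac{x}{|y|}\right)dy,$$ which maps Schwartz functions to tempered distributions.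 If $p<1$ or $q<1$, then $$H_\Phi\text{ is bounded on }M^{p,q}(\mathbb{R}^n)\iff H_\Phi=0.$$ Here "bounded on $M^{p,q}$" means that there is a constant $C$ with $\|H_\Phi f\|_{M^{p,q}}\le C\|f\|_{M^{p,q}}$ for all Schwartz functions $f$, and $H_\Phi=0$ means $H_\Phi f=0$ for all Schwartz functions $f$; the same equivalence holds if "bounded on $M^{p,q}$" is taken to mean that $H_\Phi$ extends from the Schwartz functions to a bounded linear operator on $M^{p,q}$. -/

import Mathlib

open MeasureTheory SchwartzMap
open scoped ENNReal NNReal ContDiff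

noncomputable section

namespace HausdorffModulation

/-- `ℝⁿ` with the Euclidean norm. -/
abbrev Rn (n : ℕ) : Type := EuclideanSpace ℝ (Fin n)

/-! ### The Hausdorff operator -/

/-- `H_Φ f (x) = ∫ Φ(y) f(x / |y|) dy`. -/
def hausdorffFun {n : ℕ} (Φ : Rn n → ℂ) (f : Rn n → ℂ) (x : Rn n) : ℂ :=
  ∫ y : Rn n, Φ y * f (‖y‖⁻¹ • x)

/-- `Φ` is (Lebesgue) measurable, `|y|ⁿ Φ(y)` is integrable on the unit ball and `Φ` is integrable
on its complement. -/
structure IsHausdorffKernel {n : ℕ} (Φ : Rn n → ℂ) : Prop where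
  aestronglyMeasurable : AEStronglyMeasurable Φ volume
  integrableOn_ball : IntegrableOn (fun y => ((‖y‖ ^ n : ℝ) : ℂ) * Φ y) (Metric.ball 0 1)
  integrableOn_compl : IntegrableOn Φ (Metric.ball 0 1)ᶜ

/-- The pairing `∫∫ g(x) Φ(y) f(x/|y|) dy dx` converges absolutely for Schwartz `f`, `g`, and is
controlled by the `L¹` and `L^∞` norms of `f` and `g`. -/
theorem IsHausdorffKernel.exists_bound {n : ℕ} [NeZero n] {Φ : Rn n → ℂ}
    (hΦ : IsHausdorffKernel Φ) :
    ∃ A : ℝ, 0 ≤ A ∧ ∀ f g : 𝓢(Rn n, ℂ),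
      Integrable (fun z : Rn n × Rn n => g z.1 * (Φ z.2 * f (‖z.2‖⁻¹ • z.1)))
        (volume.prod volume) ∧
      ‖∫ z : Rn n × Rn n, g z.1 * (Φ z.2 * f (‖z.2‖⁻¹ • z.1)) ∂(volume.prod volume)‖ ≤
        A * ((∫ x, ‖f x‖) * ‖toBoundedContinuousFunctionCLM ℂ (Rn n) ℂ g‖ +
          ‖toBoundedContinuousFunctionCLM ℂ (Rn n) ℂ f‖ * ∫ x, ‖g x‖) := by
  set B : Set (Rn n) := Metric.ball 0 1 with hB
  have hBm : MeasurableSet B := measurableSet_ball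
  have hi1 : Integrable (B.indicator fun y => ‖y‖ ^ n * ‖Φ y‖) := by
    rw [integrable_indicator_iff hBm]
    refine hΦ.integrableOn_ball.norm.congr (Filter.Eventually.of_forall fun y => ?_)
    simp
  have hi2 : Integrable (Bᶜ.indicator fun y => ‖Φ y‖) := by
    rw [integrable_indicator_iff hBm.compl]
    exact hΦ.integrableOn_compl.norm
  set w : Rn n → ℝ := fun y =>
    (B.indicator fun y => ‖y‖ ^ n * ‖Φ y‖) y + (Bᶜ.indicator fun y => ‖Φ y‖) y with hw
  have hwi : Integrable w := hi1.add hi2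
  have hw0 : ∀ y, 0 ≤ w y := fun y => by
    refine add_nonneg (Set.indicator_nonneg (fun y _ => by positivity) y)
      (Set.indicator_nonneg (fun y _ => by positivity) y)
  refine ⟨∫ y, w y, integral_nonneg hw0, fun f g => ?_⟩
  set Mf := ‖toBoundedContinuousFunctionCLM ℂ (Rn n) ℂ f‖
  set Mg := ‖toBoundedContinuousFunctionCLM ℂ (Rn n) ℂ g‖
  have hMf : ∀ x, ‖f x‖ ≤ Mf := fun x => by
    simpa using (toBoundedContinuousFunctionCLM ℂ (Rn n) ℂ f).norm_coe_le_norm x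
  have hMg : ∀ x, ‖g x‖ ≤ Mg := fun x => by
    simpa using (toBoundedContinuousFunctionCLM ℂ (Rn n) ℂ g).norm_coe_le_norm x
  have hMf0 : 0 ≤ Mf := norm_nonneg _
  have hMg0 : 0 ≤ Mg := norm_nonneg _
  have hfi : Integrable (fun x => ‖f x‖) := f.integrable.norm
  have hgi : Integrable (fun x => ‖g x‖) := g.integrable.norm
  have hI0 : 0 ≤ ∫ x, ‖f x‖ := integral_nonneg fun _ => norm_nonneg _
  have hJ0 : 0 ≤ ∫ x, ‖g x‖ := integral_nonneg fun _ => norm_nonneg _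
  set K := (∫ x, ‖f x‖) * Mg + Mf * ∫ x, ‖g x‖ with hK
  have hdil : Measurable fun z : Rn n × Rn n => f (‖z.2‖⁻¹ • z.1) :=
    f.continuous.measurable.comp (by fun_prop)
  have hmeas : AEStronglyMeasurable
      (fun z : Rn n × Rn n => g z.1 * (Φ z.2 * f (‖z.2‖⁻¹ • z.1)))
      (volume.prod volume) := by
    refine AEStronglyMeasurable.mul ?_ (AEStronglyMeasurable.mul ?_ ?_)
    · exact (g.continuous.comp continuous_fst).aestronglyMeasurable
    · exact hΦ.aestronglyMeasurable.comp_snd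
    · exact hdil.aestronglyMeasurable
  have hslice : ∀ y : Rn n, Integrable fun x => g x * f (‖y‖⁻¹ • x) := by
    intro y
    refine g.integrable.mul_bdd (c := Mf) ?_ (Filter.Eventually.of_forall fun x => hMf _)
    exact (f.continuous.comp (continuous_const_smul _)).aestronglyMeasurable
  have hfac : ∀ y x : Rn n,
      g x * (Φ y * f (‖y‖⁻¹ • x)) = Φ y * (g x * f (‖y‖⁻¹ • x)) := fun y x => by ring
  have hb1 : ∀ y : Rn n, ∫ x, ‖g x * f (‖y‖⁻¹ • x)‖ ≤ K := by
    intro y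
    calc ∫ x, ‖g x * f (‖y‖⁻¹ • x)‖ ≤ ∫ x, ‖g x‖ * Mf := by
          refine integral_mono (hslice y).norm (hgi.mul_const _) fun x => ?_
          simp only [norm_mul]
          exact mul_le_mul_of_nonneg_left (hMf _) (norm_nonneg _)
      _ = Mf * ∫ x, ‖g x‖ := by rw [integral_mul_const, mul_comm]
      _ ≤ K := by rw [hK]; nlinarith [mul_nonneg hI0 hMg0]
  have hb2 : ∀ y : Rn n, y ≠ 0 → ∫ x, ‖g x * f (‖y‖⁻¹ • x)‖ ≤ ‖y‖ ^ n * K := by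
    intro y hy
    have hy' : ‖y‖⁻¹ ≠ 0 := inv_ne_zero (norm_ne_zero_iff.2 hy)
    have hdi : Integrable fun x => ‖f (‖y‖⁻¹ • x)‖ := hfi.comp_smul hy'
    calc ∫ x, ‖g x * f (‖y‖⁻¹ • x)‖ ≤ ∫ x, Mg * ‖f (‖y‖⁻¹ • x)‖ := by
          refine integral_mono (hslice y).norm (hdi.const_mul _) fun x => ?_
          simp only [norm_mul]
          exact mul_le_mul_of_nonneg_right (hMg _) (norm_nonneg _)
      _ = ‖y‖ ^ n * ((∫ x, ‖f x‖) * Mg) := by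
          rw [integral_const_mul,
            Measure.integral_comp_inv_smul_of_nonneg volume (fun x => ‖f x‖) (norm_nonneg y)]
          simp only [finrank_euclideanSpace, Fintype.card_fin, smul_eq_mul]
          ring
      _ ≤ ‖y‖ ^ n * K := by
          refine mul_le_mul_of_nonneg_left ?_ (by positivity)
          rw [hK]; nlinarith [mul_nonneg hMf0 hJ0]
  have hbound : ∀ᵐ y : Rn n, ∫ x, ‖g x * (Φ y * f (‖y‖⁻¹ • x))‖ ≤ w y * K := by
    have hne : ∀ᵐ y : Rn n, y ≠ 0 := by
      have : Nonempty (Fin n) := ⟨0⟩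
      exact Measure.ae_ne volume 0
    filter_upwards [hne] with y hy
    have hcalc : ∫ x, ‖g x * (Φ y * f (‖y‖⁻¹ • x))‖ =
        ‖Φ y‖ * ∫ x, ‖g x * f (‖y‖⁻¹ • x)‖ := by
      rw [← integral_const_mul]
      refine integral_congr_ae (Filter.Eventually.of_forall fun x => ?_)
      simp only [hfac y x, norm_mul]
    rw [hcalc]
    by_cases hyB : y ∈ B
    · have : w y = ‖y‖ ^ n * ‖Φ y‖ := by simp [hw, hyB]
      rw [this]
      calc _ ≤ ‖Φ y‖ * (‖y‖ ^ n * K) := mul_le_mul_of_nonneg_left (hb2 y hy) (norm_nonneg _)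
        _ = _ := by ring
    · have : w y = ‖Φ y‖ := by simp [hw, hyB]
      rw [this]
      exact mul_le_mul_of_nonneg_left (hb1 y) (norm_nonneg _)
  have hwK : Integrable fun y => w y * K := hwi.mul_const _
  have hint : Integrable (fun z : Rn n × Rn n => g z.1 * (Φ z.2 * f (‖z.2‖⁻¹ • z.1)))
      (volume.prod volume) := by
    rw [integrable_prod_iff' hmeas]
    refine ⟨Filter.Eventually.of_forall fun y => ?_, ?_⟩
    · simp only [hfac y]
      exact (hslice y).const_mul _
    · refine hwK.mono' hmeas.norm.prod_swap.integral_prod_right' ?_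
      filter_upwards [hbound] with y hy
      rw [Real.norm_of_nonneg (integral_nonneg fun _ => norm_nonneg _)]
      exact hy
  refine ⟨hint, ?_⟩
  calc _ ≤ ∫ z : Rn n × Rn n, ‖g z.1 * (Φ z.2 * f (‖z.2‖⁻¹ • z.1))‖ ∂(volume.prod volume) :=
        norm_integral_le_integral_norm _
    _ = ∫ y : Rn n, ∫ x : Rn n, ‖g x * (Φ y * f (‖y‖⁻¹ • x))‖ :=
        integral_prod_symm _ hint.norm
    _ ≤ ∫ y, w y * K := integral_mono_ae hint.norm.integral_prod_right hwK hbound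
    _ = (∫ y, w y) * K := integral_mul_const _ _

theorem IsHausdorffKernel.integral_mul_hausdorffFun {n : ℕ} [NeZero n] {Φ : Rn n → ℂ}
    (hΦ : IsHausdorffKernel Φ) (f g : 𝓢(Rn n, ℂ)) :
    ∫ x, g x * hausdorffFun Φ f x =
      ∫ z : Rn n × Rn n, g z.1 * (Φ z.2 * f (‖z.2‖⁻¹ • z.1)) ∂(volume.prod volume) := by
  obtain ⟨A, -, hA⟩ := hΦ.exists_bound
  rw [integral_prod _ (hA f g).1]
  simp only [integral_const_mul, hausdorffFun]

/-- For Schwartz `f`, the function `H_Φ f` as the tempered distribution `g ↦ ∫ g(x) H_Φ f(x) dx`. -/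
def hausdorffDistribution {n : ℕ} [NeZero n] {Φ : Rn n → ℂ} (hΦ : IsHausdorffKernel Φ)
    (f : 𝓢(Rn n, ℂ)) : 𝓢'(Rn n, ℂ) :=
  ContinuousLinearMap.toPointwiseConvergenceCLM _ _ _ _
    { toFun := fun g => ∫ x, g x * hausdorffFun Φ f x
      map_add' := fun g₁ g₂ => by
        obtain ⟨A, -, hA⟩ := hΦ.exists_bound
        simp only [hΦ.integral_mul_hausdorffFun]
        rw [← integral_add (hA f g₁).1 (hA f g₂).1]
        simp only [add_apply, add_mul]
      map_smul' := fun c g => by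
        simp only [smul_apply, smul_eq_mul, mul_assoc, integral_const_mul,
          RingHom.id_apply]
      cont := by
        obtain ⟨A, hA0, hA⟩ := hΦ.exists_bound
        let L : 𝓢(Rn n, ℂ) →+ ℂ :=
          { toFun := fun g => ∫ x, g x * hausdorffFun Φ f x
            map_zero' := by simp
            map_add' := fun g₁ g₂ => by
              simp only [hΦ.integral_mul_hausdorffFun]
              rw [← integral_add (hA f g₁).1 (hA f g₂).1]
              simp only [add_apply, add_mul] }
        change Continuous L
        refine continuous_of_continuousAt_zero L ?_
        rw [ContinuousAt, map_zero]
        have hcont : Continuous fun g : 𝓢(Rn n, ℂ) =>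
            A * ((∫ x, ‖f x‖) * ‖toBoundedContinuousFunctionCLM ℂ (Rn n) ℂ g‖ +
              ‖toBoundedContinuousFunctionCLM ℂ (Rn n) ℂ f‖ * ‖toLpCLM ℂ ℂ 1 volume g‖) := by
          have h1 := (toBoundedContinuousFunctionCLM ℂ (Rn n) ℂ).continuous.norm
          have h2 := (toLpCLM ℂ ℂ 1 (volume : Measure (Rn n))).continuous.norm
          exact continuous_const.mul ((continuous_const.mul h1).add (continuous_const.mul h2))
        refine squeeze_zero_norm (a := fun g : 𝓢(Rn n, ℂ) =>
            A * ((∫ x, ‖f x‖) * ‖toBoundedContinuousFunctionCLM ℂ (Rn n) ℂ g‖ +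
              ‖toBoundedContinuousFunctionCLM ℂ (Rn n) ℂ f‖ * ‖toLpCLM ℂ ℂ 1 volume g‖))
          (fun g => ?_) ?_
        · have h := (hA f g).2
          rw [← hΦ.integral_mul_hausdorffFun] at h
          rw [toLpCLM_apply, norm_toLp_one]
          exact h
        · have h0 := hcont.tendsto 0
          simpa only [map_zero, norm_zero, mul_zero, add_zero] using h0 }

theorem hausdorffDistribution_apply {n : ℕ} [NeZero n] {Φ : Rn n → ℂ}
    (hΦ : IsHausdorffKernel Φ) (f g : 𝓢(Rn n, ℂ)) :
    hausdorffDistribution hΦ f g = ∫ x, g x * hausdorffFun Φ f x := rfl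

/-- The Hausdorff operator `H_Φ` as a linear operator from Schwartz functions to tempered
distributions. -/
def hausdorffOp {n : ℕ} [NeZero n] {Φ : Rn n → ℂ} (hΦ : IsHausdorffKernel Φ) :
    𝓢(Rn n, ℂ) →ₗ[ℂ] 𝓢'(Rn n, ℂ) where
  toFun := hausdorffDistribution hΦ
  map_add' f₁ f₂ := by
    obtain ⟨A, -, hA⟩ := hΦ.exists_bound
    ext g
    change hausdorffDistribution hΦ (f₁ + f₂) g =
      hausdorffDistribution hΦ f₁ g + hausdorffDistribution hΦ f₂ g
    simp only [hausdorffDistribution_apply, hΦ.integral_mul_hausdorffFun]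
    rw [← integral_add (hA f₁ g).1 (hA f₂ g).1]
    simp only [add_apply, mul_add]
  map_smul' c f := by
    ext g
    change hausdorffDistribution hΦ (c • f) g = c * hausdorffDistribution hΦ f g
    simp only [hausdorffDistribution_apply, hΦ.integral_mul_hausdorffFun]
    rw [← integral_const_mul]
    simp only [smul_apply, smul_eq_mul]
    congr 1
    ext z
    ring

/-! ### Modulation spaces -/

/-- The lattice point `k ∈ ℤⁿ` as a vector of `ℝⁿ`. -/
def latticePoint {n : ℕ} (k : Fin n → ℤ) : Rn n := WithLp.toLp 2 fun i => (k i : ℝ)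

/-- `η : ℝⁿ → [0,1]` is smooth, equal to `1` for `|ξ|_∞ ≤ 1/2` and to `0` for `|ξ|_∞ ≥ 3/4`. -/
structure IsWindow {n : ℕ} (η : Rn n → ℝ) : Prop where
  contDiff : ContDiff ℝ ∞ η
  mem_Icc : ∀ ξ, η ξ ∈ Set.Icc (0 : ℝ) 1
  eq_one : ∀ ξ, (∀ i, |ξ i| ≤ 1 / 2) → η ξ = 1
  eq_zero : ∀ ξ, (∃ i, 3 / 4 ≤ |ξ i|) → η ξ = 0

/-- `σ_k(ξ) = η(ξ - k) (∑_{l ∈ ℤⁿ} η(ξ - l))⁻¹`; for a window `η` the sum is locally finite and at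
least `1`. -/
def partitionFun {n : ℕ} (η : Rn n → ℝ) (k : Fin n → ℤ) (ξ : Rn n) : ℝ :=
  η (ξ - latticePoint k) * (∑' l : Fin n → ℤ, η (ξ - latticePoint l))⁻¹

/-- The frequency-uniform decomposition operator `□_k = 𝓕⁻¹ σ_k 𝓕` on tempered distributions. -/
def boxOp {n : ℕ} (η : Rn n → ℝ) (k : Fin n → ℤ) : 𝓢'(Rn n, ℂ) →L[ℂ] 𝓢'(Rn n, ℂ) :=
  TemperedDistribution.fourierMultiplierCLM ℂ fun ξ => (partitionFun η k ξ : ℂ)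

/-- The tempered distribution `u` is given by the function `h`. -/
def IsGivenBy {n : ℕ} (u : 𝓢'(Rn n, ℂ)) (h : Rn n → ℂ) : Prop :=
  ∀ g : 𝓢(Rn n, ℂ), Integrable (fun x => g x * h x) ∧ u g = ∫ x, g x * h x

/-- The `L^p` (quasi-)norm of a tempered distribution: that of the function which it is given by
(unique almost everywhere), and `∞` if there is none. -/
def distLpNorm {n : ℕ} (p : ℝ≥0∞) (u : 𝓢'(Rn n, ℂ)) : ℝ≥0∞ :=
  ⨅ (h : Rn n → ℂ) (_ : IsGivenBy u h), eLpNorm h p volume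

/-- The `ℓ^q` (quasi-)norm of a family of elements of `[0,∞]`, for `0 < q ≤ ∞`. -/
def lqNorm {ι : Type*} (q : ℝ≥0∞) (a : ι → ℝ≥0∞) : ℝ≥0∞ :=
  if q = ⊤ then ⨆ i, a i else (∑' i, a i ^ q.toReal) ^ (1 / q.toReal)

/-- The (quasi-)norm of `M^{p,q}(ℝⁿ)`; the space consists of the tempered distributions for which it
is finite. -/
def modulationNorm {n : ℕ} (η : Rn n → ℝ) (p q : ℝ≥0∞) (u : 𝓢'(Rn n, ℂ)) : ℝ≥0∞ :=
  lqNorm q fun k : Fin n → ℤ => distLpNorm p (boxOp η k u)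

/-- `u ∈ M^{p,q}(ℝⁿ)`. -/
def MemModulation {n : ℕ} (η : Rn n → ℝ) (p q : ℝ≥0∞) (u : 𝓢'(Rn n, ℂ)) : Prop :=
  modulationNorm η p q u < ⊤

/-! ### Boundedness -/

/-- `‖H f‖_{M^{p,q}} ≤ C ‖f‖_{M^{p,q}}` for all Schwartz functions `f`. -/
def IsBoundedOnModulation {n : ℕ} (η : Rn n → ℝ) (p q : ℝ≥0∞)
    (H : 𝓢(Rn n, ℂ) →ₗ[ℂ] 𝓢'(Rn n, ℂ)) : Prop :=
  ∃ C : ℝ≥0, ∀ f : 𝓢(Rn n, ℂ),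
    modulationNorm η p q (H f) ≤
      C * modulationNorm η p q (toTemperedDistributionCLM (Rn n) ℂ volume f)

/-- `H` extends from Schwartz functions to a bounded linear operator on all of `M^{p,q}`.
Every linear operator on the subspace `M^{p,q}` is the restriction of a linear
operator `T` on the tempered distributions, whose values off `M^{p,q}` play no role here. -/
def HasBoundedExtension {n : ℕ} (η : Rn n → ℝ) (p q : ℝ≥0∞)
    (H : 𝓢(Rn n, ℂ) →ₗ[ℂ] 𝓢'(Rn n, ℂ)) : Prop :=
  ∃ T : 𝓢'(Rn n, ℂ) →ₗ[ℂ] 𝓢'(Rn n, ℂ),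
    (∀ f : 𝓢(Rn n, ℂ), T (toTemperedDistributionCLM (Rn n) ℂ volume f) = H f) ∧
    ∃ C : ℝ≥0, ∀ u : 𝓢'(Rn n, ℂ), MemModulation η p q u →
      modulationNorm η p q (T u) ≤ C * modulationNorm η p q u

end HausdorffModulation

end

noncomputable section

open Filter Topology FourierTransform

namespace HausdorffModulation

/-! ### The lattice partition of unity -/

/-! Below exponent one, a bounded quasi-norm together with a vanishing supremum forces a vanishing
`L¹` or `ℓ¹` norm, because |h| = |h|^(1-p) |h|^p. If H_Φ is bounded, this makes certain pairings
tend to 0, while a direct computation of their limits recovers H_Φ.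

The vanishing supremum does not use boundedness. If f and g are localised near a and b, then H_Φ f
(g) is controlled by the mass of those y for which |y|a is close to b. As |a| + |b| → ∞ such y
accumulate only on a sphere, which is a null set (`exists_concentration_le`,
`exists_norm_hausdorffOp_apply_le`).

Case p < 1. Take g with Fourier support near 0 and translate it to Nz with z ≠ 0; its quasi-norm
stays fixed. The function □_0 H_Φ(g(· - Nz)) is bounded in L^p and tends to 0 uniformly, hence in
L¹, so its pairing with w(x/N) tends to 0, where w = 𝓕W and W has compact support. For large N the
test function has frequencies where σ_0 = 1, so □_0 may be dropped. The same pairing tends to ∫ Φ(y)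
|y|^n w(|y|z) dy · ∫ g (`tendsto_hausdorffOp_translate`). Hence these integrals vanish, and H_Φ f
(𝓕W) = 0 for every f.

Case q < 1 ≤ p. This is the Fourier mirror image. Modulate g to the lattice frequency ⌊Nz⌋ and test
against 𝓕V with V = W(·/N). The pairing is a finite sum of the pairings of the □_k; these are small
uniformly in k, and their ℓ^q norm is bounded through Hölder's inequality, so the sum tends to 0.
The Fourier transform moves the pairing to H_Φ V against a bump at ⌊Nz⌋, whose limit is a nonzero
multiple of H_Φ W(z) (`tendsto_hausdorffOp_modulate`).

In both cases H_Φ W = 0 for compactly supported W, directly or through `hausdorffOp_apply_fourier`,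
and cutoffs extend this to all Schwartz functions. -/

theorem abs_apply_le_norm {n : ℕ} (x : Rn n) (i : Fin n) : |x i| ≤ ‖x‖ := by
  simpa using PiLp.norm_apply_le x i

theorem norm_le_of_forall_abs_le_one {n : ℕ} {x : Rn n} (h : ∀ i, |x i| ≤ 1) : ‖x‖ ≤ n := by
  rw [EuclideanSpace.norm_eq]
  refine Real.sqrt_le_iff.2 ⟨by positivity, ?_⟩
  calc ∑ i, ‖x i‖ ^ 2 ≤ ∑ _i : Fin n, (1 : ℝ) := by
        refine Finset.sum_le_sum fun i _ => ?_
        rw [Real.norm_eq_abs]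
        exact pow_le_one₀ (abs_nonneg _) (h i)
    _ = n := by simp
    _ ≤ (n : ℝ) ^ 2 := by
        rcases Nat.eq_zero_or_pos n with rfl | hn
        · simp
        · have : (1 : ℝ) ≤ n := by exact_mod_cast hn
          nlinarith

@[simp] theorem latticePoint_apply {n : ℕ} (k : Fin n → ℤ) (i : Fin n) :
    latticePoint k i = k i := rfl

theorem finite_lattice_near {n : ℕ} (ξ : Rn n) (c : ℝ) :
    {l : Fin n → ℤ | ∀ i, |ξ i - l i| ≤ c}.Finite := by
  refine (Set.finite_Icc (fun i => ⌊ξ i - c⌋) (fun i => ⌈ξ i + c⌉)).subset fun l hl => ?_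
  refine ⟨fun i => ?_, fun i => ?_⟩
  · have := abs_le.1 (hl i)
    have h : (⌊ξ i - c⌋ : ℝ) ≤ l i := (Int.floor_le _).trans (by linarith)
    exact_mod_cast h
  · have := abs_le.1 (hl i)
    have h : (l i : ℝ) ≤ ⌈ξ i + c⌉ := le_trans (by linarith) (Int.le_ceil _)
    exact_mod_cast h

namespace IsWindow

variable {n : ℕ} {η : Rn n → ℝ} (hη : IsWindow η)
include hη

theorem abs_sub_lt_of_ne_zero {ξ : Rn n} {l : Fin n → ℤ} (h : η (ξ - latticePoint l) ≠ 0)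
    (i : Fin n) : |ξ i - l i| < 3 / 4 := by
  by_contra! hc
  exact h (hη.eq_zero _ ⟨i, by simpa using hc⟩)

theorem finite_support_translates (ξ : Rn n) :
    (Function.support fun l : Fin n → ℤ => η (ξ - latticePoint l)).Finite :=
  (finite_lattice_near ξ 1).subset fun _ hl i =>
    (hη.abs_sub_lt_of_ne_zero hl i).le.trans (by norm_num)

theorem one_le_tsum (ξ : Rn n) : 1 ≤ ∑' l : Fin n → ℤ, η (ξ - latticePoint l) := by
  have h1 : η (ξ - latticePoint fun i => round (ξ i)) = 1 :=
    hη.eq_one _ fun i => by simpa using abs_sub_round (ξ i)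
  rw [← h1]
  exact (summable_of_hasFiniteSupport (hη.finite_support_translates ξ)).le_tsum _
    fun l _ => (hη.mem_Icc _).1

theorem contDiff_tsum : ContDiff ℝ ∞ fun ξ => ∑' l : Fin n → ℤ, η (ξ - latticePoint l) := by
  refine contDiff_iff_contDiffAt.2 fun ξ₀ => ?_
  -- Radius 2 suffices on the unit ball about ξ₀: a nonzero term has ξ within 3/4 of l in each
  -- coordinate, and 3/4 + 1 < 2.
  set S := (finite_lattice_near ξ₀ 2).toFinset
  have heq : (fun ξ => ∑' l : Fin n → ℤ, η (ξ - latticePoint l)) =ᶠ[𝓝 ξ₀]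
      fun ξ => ∑ l ∈ S, η (ξ - latticePoint l) := by
    filter_upwards [Metric.ball_mem_nhds ξ₀ one_pos] with ξ hξ
    refine tsum_eq_sum fun l hl => ?_
    by_contra hne
    refine hl ((Set.Finite.mem_toFinset _).2 fun i => ?_)
    have h1 := hη.abs_sub_lt_of_ne_zero hne i
    have h2 : |ξ i - ξ₀ i| < 1 :=
      (abs_apply_le_norm (ξ - ξ₀) i).trans_lt (mem_ball_iff_norm.1 hξ)
    rw [abs_lt] at h1 h2
    rw [abs_le]
    constructor <;> linarith
  refine ContDiffAt.congr_of_eventuallyEq ?_ heq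
  refine ContDiff.contDiffAt (ContDiff.sum fun l _ => ?_)
  exact hη.contDiff.comp (contDiff_id.sub contDiff_const)

theorem contDiff_partitionFun (k : Fin n → ℤ) : ContDiff ℝ ∞ (partitionFun η k) := by
  refine (hη.contDiff.comp (contDiff_id.sub contDiff_const)).mul (hη.contDiff_tsum.inv fun ξ => ?_)
  have := hη.one_le_tsum ξ
  positivity

theorem abs_sub_lt_of_partitionFun_ne_zero {k : Fin n → ℤ} {ξ : Rn n}
    (h : partitionFun η k ξ ≠ 0) (i : Fin n) : |ξ i - k i| < 3 / 4 :=
  hη.abs_sub_lt_of_ne_zero (left_ne_zero_of_mul h) i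

theorem norm_sub_le_of_partitionFun_ne_zero {k : Fin n → ℤ} {ξ : Rn n}
    (h : partitionFun η k ξ ≠ 0) : ‖ξ - latticePoint k‖ ≤ n :=
  norm_le_of_forall_abs_le_one fun i => by
    simpa using (hη.abs_sub_lt_of_partitionFun_ne_zero h i).le.trans (by norm_num)

theorem hasCompactSupport_partitionFun (k : Fin n → ℤ) : HasCompactSupport (partitionFun η k) := by
  refine HasCompactSupport.intro (isCompact_closedBall (latticePoint k) n) fun ξ hξ => ?_
  by_contra h
  exact hξ (mem_closedBall_iff_norm.2 (hη.norm_sub_le_of_partitionFun_ne_zero h))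

theorem tsum_partitionFun (ξ : Rn n) : ∑' k, partitionFun η k ξ = 1 := by
  simp only [partitionFun, tsum_mul_right]
  exact mul_inv_cancel₀ (by have := hη.one_le_tsum ξ; positivity)

theorem finite_support_partitionFun (ξ : Rn n) :
    (Function.support fun k => partitionFun η k ξ).Finite :=
  (hη.finite_support_translates ξ).subset fun _ h => left_ne_zero_of_mul h

theorem partitionFun_nonneg (k : Fin n → ℤ) (ξ : Rn n) : 0 ≤ partitionFun η k ξ :=
  mul_nonneg (hη.mem_Icc _).1 (inv_nonneg.2 (zero_le_one.trans (hη.one_le_tsum ξ)))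

theorem partitionFun_le_one (k : Fin n → ℤ) (ξ : Rn n) : partitionFun η k ξ ≤ 1 := by
  rw [← hη.tsum_partitionFun ξ]
  exact (summable_of_hasFiniteSupport (hη.finite_support_partitionFun ξ)).le_tsum k
    fun l _ => hη.partitionFun_nonneg l ξ

/-- `σ_l` vanishes near the other lattice points. -/
theorem partitionFun_eq_zero_of_ne {k l : Fin n → ℤ} (hkl : l ≠ k) {ξ : Rn n}
    (hξ : ‖ξ - latticePoint k‖ ≤ 1 / 4) : partitionFun η l ξ = 0 := by
  by_contra h
  refine hkl (funext fun i => ?_)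
  have h1 := hη.abs_sub_lt_of_partitionFun_ne_zero h i
  have h2 : |ξ i - k i| ≤ 1 / 4 := (abs_apply_le_norm (ξ - latticePoint k) i).trans hξ
  rw [abs_lt] at h1
  rw [abs_le] at h2
  have h3 : (l i : ℝ) < k i + 1 := by linarith
  have h4 : (k i : ℝ) < l i + 1 := by linarith
  have h3' : l i < k i + 1 := by exact_mod_cast h3
  have h4' : k i < l i + 1 := by exact_mod_cast h4
  omega

theorem partitionFun_eq_one {k : Fin n → ℤ} {ξ : Rn n}
    (hξ : ‖ξ - latticePoint k‖ ≤ 1 / 4) : partitionFun η k ξ = 1 := by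
  rw [← hη.tsum_partitionFun ξ, tsum_eq_single k]
  exact fun l hl => hη.partitionFun_eq_zero_of_ne hl hξ

/-- `σ_k` as a Schwartz function. -/
def partitionSchwartz (k : Fin n → ℤ) : 𝓢(Rn n, ℂ) :=
  HasCompactSupport.toSchwartzMap (f := fun ξ => (partitionFun η k ξ : ℂ))
    ((hη.hasCompactSupport_partitionFun k).comp_left Complex.ofReal_zero)
    (Complex.ofRealCLM.contDiff.comp (hη.contDiff_partitionFun k))

theorem hasTemperateGrowth_partitionFun (k : Fin n → ℤ) :
    Function.HasTemperateGrowth fun ξ => (partitionFun η k ξ : ℂ) :=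
  (hη.partitionSchwartz k).hasTemperateGrowth

end IsWindow

/-! ### Functions representing a tempered distribution -/

/-- Testing against a bump equal to 1 near x shows integrability there. This gives measurability of
representatives and makes the uniqueness argument of `IsGivenBy.ae_eq` available. -/
theorem IsGivenBy.locallyIntegrable {n : ℕ} {u : 𝓢'(Rn n, ℂ)} {h : Rn n → ℂ}
    (hu : IsGivenBy u h) : LocallyIntegrable h := by
  intro x
  let b : ContDiffBump x := ⟨1, 2, one_pos, one_lt_two⟩
  let g : 𝓢(Rn n, ℂ) := HasCompactSupport.toSchwartzMap (f := fun ξ => ((b ξ : ℝ) : ℂ))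
    (b.hasCompactSupport.comp_left Complex.ofReal_zero) (Complex.ofRealCLM.contDiff.comp b.contDiff)
  refine ⟨Metric.closedBall x 1, Metric.closedBall_mem_nhds x one_pos, ?_⟩
  refine ((hu g).1.integrableOn (s := Metric.closedBall x 1)).congr_fun (fun y hy => ?_)
    measurableSet_closedBall
  have : g y = 1 := by
    change ((b y : ℝ) : ℂ) = 1
    rw [b.one_of_mem_closedBall hy, Complex.ofReal_one]
  simp [this]

theorem IsGivenBy.ae_eq {n : ℕ} {u : 𝓢'(Rn n, ℂ)} {h₁ h₂ : Rn n → ℂ}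
    (hu₁ : IsGivenBy u h₁) (hu₂ : IsGivenBy u h₂) : h₁ =ᵐ[volume] h₂ := by
  refine ae_eq_of_integral_contDiff_smul_eq hu₁.locallyIntegrable hu₂.locallyIntegrable
    fun g hg hgc => ?_
  let G : 𝓢(Rn n, ℂ) := HasCompactSupport.toSchwartzMap (f := fun ξ => ((g ξ : ℝ) : ℂ))
    (hgc.comp_left Complex.ofReal_zero) (Complex.ofRealCLM.contDiff.comp hg)
  have h := (hu₁ G).2.symm.trans (hu₂ G).2
  simp only [Complex.real_smul]
  exact h

theorem IsGivenBy.distLpNorm_eq {n : ℕ} {u : 𝓢'(Rn n, ℂ)} {h : Rn n → ℂ}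
    (hu : IsGivenBy u h) (p : ℝ≥0∞) : distLpNorm p u = eLpNorm h p volume := by
  refine le_antisymm (iInf₂_le h hu) (le_iInf₂ fun h' hu' => ?_)
  rw [eLpNorm_congr_ae (hu.ae_eq hu')]

theorem isGivenBy_toTemperedDistribution {n : ℕ} (f : 𝓢(Rn n, ℂ)) :
    IsGivenBy (toTemperedDistributionCLM (Rn n) ℂ volume f) f := fun g =>
  ⟨f.integrable.bdd_mul (c := SchwartzMap.seminorm ℂ 0 0 g) g.continuous.aestronglyMeasurable
    (Eventually.of_forall fun x => norm_le_seminorm ℂ g x), 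
    toTemperedDistributionCLM_apply_apply volume f g⟩

theorem isGivenBy_zero {n : ℕ} : IsGivenBy (0 : 𝓢'(Rn n, ℂ)) 0 := fun g => by
  refine ⟨by simp, ?_⟩
  simp only [Pi.zero_apply, mul_zero, integral_zero]
  rfl

@[simp] theorem distLpNorm_zero {n : ℕ} (p : ℝ≥0∞) : distLpNorm p (0 : 𝓢'(Rn n, ℂ)) = 0 := by
  rw [isGivenBy_zero.distLpNorm_eq, eLpNorm_zero]

/-- Hölder's inequality for each representative. The bound `B`, nonzero and finite, replaces the
dual norm of `S` so that one can divide by it before passing to the infimum; without a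
representative the infimum is `⊤` and nothing is claimed. -/
theorem enorm_apply_le_distLpNorm_mul {n : ℕ} {p p' : ℝ≥0∞} [p.HolderConjugate p']
    (u : 𝓢'(Rn n, ℂ)) (S : 𝓢(Rn n, ℂ)) {B : ℝ≥0∞} (hB : eLpNorm S p' volume ≤ B)
    (hB0 : B ≠ 0) (hBtop : B ≠ ⊤) : ‖u S‖ₑ ≤ distLpNorm p u * B := by
  rw [← ENNReal.div_le_iff hB0 hBtop]
  refine le_iInf₂ fun h hu => ?_
  rw [ENNReal.div_le_iff hB0 hBtop, (hu S).2]
  calc ‖∫ x, S x * h x‖ₑ ≤ ∫⁻ x, ‖S x * h x‖ₑ := enorm_integral_le_lintegral_enorm _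
    _ = eLpNorm (h • (S : Rn n → ℂ)) 1 volume := by
        rw [eLpNorm_one_eq_lintegral_enorm]
        simp only [Pi.smul_apply', smul_eq_mul, mul_comm]
    _ ≤ eLpNorm h p volume * eLpNorm S p' volume :=
        eLpNorm_smul_le_mul_eLpNorm S.continuous.aestronglyMeasurable
          hu.locallyIntegrable.aestronglyMeasurable
    _ ≤ _ := by gcongr

/-! ### The sequence norm and the modulation norm -/

section lqNorm

variable {ι : Type*} {q : ℝ≥0∞}

theorem le_lqNorm (hq : 0 < q) (a : ι → ℝ≥0∞) (i : ι) : a i ≤ lqNorm q a := by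
  rw [lqNorm]
  split_ifs with h
  · exact le_iSup a i
  · have hq' : 0 < q.toReal := ENNReal.toReal_pos hq.ne' h
    calc a i = (a i ^ q.toReal) ^ (1 / q.toReal) := by
          rw [← ENNReal.rpow_mul, mul_one_div_cancel hq'.ne', ENNReal.rpow_one]
      _ ≤ _ := ENNReal.rpow_le_rpow (ENNReal.le_tsum i) (by positivity)

theorem lqNorm_eq_of_forall_ne (hq : 0 < q) {a : ι → ℝ≥0∞} (i : ι) (ha : ∀ j, j ≠ i → a j = 0) :
    lqNorm q a = a i := by
  refine le_antisymm ?_ (le_lqNorm hq a i)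
  rw [lqNorm]
  split_ifs with h
  · refine iSup_le fun j => ?_
    by_cases hj : j = i
    · rw [hj]
    · simp [ha j hj]
  · have hq' : 0 < q.toReal := ENNReal.toReal_pos hq.ne' h
    rw [tsum_eq_single i fun j hj => by rw [ha j hj, ENNReal.zero_rpow_of_pos hq'],
      ← ENNReal.rpow_mul, mul_one_div_cancel hq'.ne', ENNReal.rpow_one]

theorem lqNorm_zero (hq : 0 < q) : lqNorm q (fun _ : ι => (0 : ℝ≥0∞)) = 0 := by
  rw [lqNorm]
  split_ifs with h
  · simp
  · have hq' : 0 < q.toReal := ENNReal.toReal_pos hq.ne' h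
    simp [ENNReal.zero_rpow_of_pos hq', hq']

theorem sum_rpow_le_lqNorm_rpow (hq : 0 < q) (h : q ≠ ⊤) (a : ι → ℝ≥0∞) (s : Finset ι) :
    ∑ i ∈ s, a i ^ q.toReal ≤ lqNorm q a ^ q.toReal := by
  have hq' : 0 < q.toReal := ENNReal.toReal_pos hq.ne' h
  rw [lqNorm, if_neg h, ← ENNReal.rpow_mul, one_div_mul_cancel hq'.ne', ENNReal.rpow_one]
  exact ENNReal.sum_le_tsum s

end lqNorm

theorem modulationNorm_zero {n : ℕ} (η : Rn n → ℝ) (p : ℝ≥0∞) {q : ℝ≥0∞} (hq : 0 < q) :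
    modulationNorm η p q 0 = 0 := by
  simp only [modulationNorm, map_zero, distLpNorm_zero]
  exact lqNorm_zero hq

theorem boxOp_apply_fourier {n : ℕ} (η : Rn n → ℝ) (k : Fin n → ℤ) (u : 𝓢'(Rn n, ℂ))
    (W : 𝓢(Rn n, ℂ)) :
    boxOp η k u (𝓕 W) = u (𝓕 (smulLeftCLM ℂ (fun ξ => (partitionFun η k ξ : ℂ)) W)) := by
  rw [boxOp, TemperedDistribution.fourierMultiplierCLM_apply_apply,
    FourierTransform.fourierInv_fourier_eq]

/-- On such a support σ_k = 1 and every other σ_l vanishes, so □_k fixes f and the remaining blocks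
are zero. -/
theorem IsWindow.modulationNorm_le_of_fourier_support {n : ℕ} {η : Rn n → ℝ} (hη : IsWindow η)
    (p : ℝ≥0∞) {q : ℝ≥0∞} (hq : 0 < q) (k : Fin n → ℤ) (f : 𝓢(Rn n, ℂ))
    (hf : ∀ ξ, 𝓕 f ξ ≠ 0 → ‖ξ - latticePoint k‖ ≤ 1 / 4) :
    modulationNorm η p q (toTemperedDistributionCLM (Rn n) ℂ volume f) ≤ eLpNorm f p volume := by
  have hbox : ∀ l, boxOp η l (toTemperedDistributionCLM (Rn n) ℂ volume f) =
      toTemperedDistributionCLM (Rn n) ℂ volume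
        (𝓕⁻ (smulLeftCLM ℂ (fun ξ => (partitionFun η l ξ : ℂ)) (𝓕 f))) := fun l =>
    TemperedDistribution.fourierMultiplierCLM_toTemperedDistributionCLM_eq
      (hη.hasTemperateGrowth_partitionFun l) f
  have hk : smulLeftCLM ℂ (fun ξ => (partitionFun η k ξ : ℂ)) (𝓕 f) = 𝓕 f := by
    ext ξ
    rw [smulLeftCLM_apply_apply (hη.hasTemperateGrowth_partitionFun k)]
    by_cases h : 𝓕 f ξ = 0
    · simp [h]
    · simp [hη.partitionFun_eq_one (hf ξ h)]
  have hl : ∀ l, l ≠ k → smulLeftCLM ℂ (fun ξ => (partitionFun η l ξ : ℂ)) (𝓕 f) = 0 := by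
    intro l hlk
    ext ξ
    rw [smulLeftCLM_apply_apply (hη.hasTemperateGrowth_partitionFun l)]
    by_cases h : 𝓕 f ξ = 0
    · simp [h]
    · simp [hη.partitionFun_eq_zero_of_ne hlk (hf ξ h)]
  rw [modulationNorm, lqNorm_eq_of_forall_ne hq k]
  · rw [hbox, hk, FourierTransform.fourierInv_fourier_eq,
      (isGivenBy_toTemperedDistribution f).distLpNorm_eq]
  · intro l hlk
    rw [hbox, hl l hlk, FourierTransform.fourierInv_zero, map_zero, distLpNorm_zero]

/-! ### Dilations and the Fourier transform of Schwartz functions -/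

/-- The dilate `x ↦ f (c x)` of a Schwartz function. -/
def dilate {n : ℕ} (c : ℝ) (hc : c ≠ 0) (f : 𝓢(Rn n, ℂ)) : 𝓢(Rn n, ℂ) :=
  compCLMOfContinuousLinearEquiv ℂ
    (ContinuousLinearEquiv.smulLeft (R₁ := ℝ) (M₁ := Rn n) (Units.mk0 c hc)) f

@[simp] theorem dilate_apply {n : ℕ} (c : ℝ) (hc : c ≠ 0) (f : 𝓢(Rn n, ℂ)) (x : Rn n) :
    dilate c hc f x = f (c • x) := rfl

theorem fourier_dilate_apply {n : ℕ} {c : ℝ} (hc : 0 < c) (f : 𝓢(Rn n, ℂ)) (ξ : Rn n) :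
    𝓕 (dilate c hc.ne' f) ξ = ((c ^ n)⁻¹ : ℝ) * 𝓕 f (c⁻¹ • ξ) := by
  rw [fourier_coe, fourier_coe, Real.fourier_eq, Real.fourier_eq]
  have h := Measure.integral_comp_smul_of_nonneg volume
    (fun v : Rn n => Real.fourierChar (-inner ℝ v (c⁻¹ • ξ)) • f v) c (hR := hc.le)
  simp only [finrank_euclideanSpace, Fintype.card_fin, Complex.real_smul] at h
  rw [← h]
  refine integral_congr_ae (Eventually.of_forall fun v => ?_)
  simp only [inner_smul_left, inner_smul_right, dilate_apply]
  simp [inv_mul_cancel_left₀ hc.ne']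

theorem fourier_compSubConst_apply {n : ℕ} (f : 𝓢(Rn n, ℂ)) (a ξ : Rn n) :
    𝓕 (compSubConstCLM ℂ a f) ξ = Real.fourierChar (-inner ℝ a ξ) • 𝓕 f ξ := by
  rw [fourier_coe, fourier_coe, Real.fourier_eq, Real.fourier_eq,
    ← integral_sub_right_eq_self _ (-a)]
  simp only [Circle.smul_def]
  rw [← integral_smul]
  refine integral_congr_ae (Eventually.of_forall fun v => ?_)
  simp only [compSubConstCLM_apply, sub_neg_eq_add, add_sub_cancel_right, inner_add_left, neg_add]
  rw [AddChar.map_add_eq_mul, mul_comm, Circle.coe_mul, mul_smul]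

theorem norm_fourier_compSubConst_apply {n : ℕ} (f : 𝓢(Rn n, ℂ)) (a ξ : Rn n) :
    ‖𝓕 (compSubConstCLM ℂ a f) ξ‖ = ‖𝓕 f ξ‖ := by
  rw [fourier_compSubConst_apply, Circle.norm_smul]

/-- The Fourier transform of a product is the convolution of the Fourier transforms. -/
theorem fourier_smulLeft_apply {n : ℕ} (χ V : 𝓢(Rn n, ℂ)) (x : Rn n) :
    𝓕 (smulLeftCLM ℂ χ V) x = ∫ s, 𝓕 χ (x - s) * 𝓕 V s := by
  have hneg : ∀ (f : 𝓢(Rn n, ℂ)) (y : Rn n), 𝓕 f y = 𝓕⁻ f (-y) := fun f y => by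
    rw [fourier_coe, fourierInv_coe, Real.fourierInv_eq_fourier_neg, neg_neg]
  have hpair : smulLeftCLM ℂ χ V = pairing (ContinuousLinearMap.mul ℂ ℂ) χ V := by
    ext y
    rw [smulLeftCLM_apply_apply χ.hasTemperateGrowth, pairing_apply_apply]
    rfl
  -- The convolution theorem, applied to the inverse transforms of the two factors; the reflection x
  -- ↦ -x then converts 𝓕⁻ back to 𝓕.
  have hconv : 𝓕⁻ (smulLeftCLM ℂ χ V) =
      SchwartzMap.convolution (ContinuousLinearMap.mul ℂ ℂ) (𝓕⁻ χ) (𝓕⁻ V) := by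
    have h := congrArg (fun u : 𝓢(Rn n, ℂ) => (𝓕⁻ u : 𝓢(Rn n, ℂ)))
      (fourier_convolution (ContinuousLinearMap.mul ℂ ℂ) (𝓕⁻ χ : 𝓢(Rn n, ℂ)) (𝓕⁻ V))
    simp only [FourierTransform.fourierInv_fourier_eq,
      FourierTransform.fourier_fourierInv_eq] at h
    rw [h, hpair]
  rw [hneg, hconv, SchwartzMap.convolution_apply, MeasureTheory.convolution]
  rw [← integral_sub_left_eq_self (fun s => 𝓕 χ (x - s) * 𝓕 V s) volume x,
    ← integral_neg_eq_self]
  refine integral_congr_ae (Eventually.of_forall fun s => ?_)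
  simp only [ContinuousLinearMap.mul_apply', hneg]
  congr 2 <;> abel_nf

theorem exists_decay {n : ℕ} (f : 𝓢(Rn n, ℂ)) (m : ℕ) :
    ∃ C : ℝ, 0 ≤ C ∧ ∀ x, (1 + ‖x‖) ^ m * ‖f x‖ ≤ C := by
  refine ⟨2 ^ m * (Finset.Iic (m, 0)).sup (fun m => SchwartzMap.seminorm ℂ m.1 m.2) f,
    by positivity, fun x => ?_⟩
  simpa using one_add_le_sup_seminorm_apply (𝕜 := ℂ) (m := (m, 0)) le_rfl le_rfl f x

/-- Smooth cutoffs of a Schwartz function. -/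
def cutoff {n : ℕ} (f : 𝓢(Rn n, ℂ)) (j : ℕ) : 𝓢(Rn n, ℂ) :=
  let b : ContDiffBump (0 : Rn n) := ⟨j + 1, j + 2, by positivity, by linarith⟩
  HasCompactSupport.toSchwartzMap (f := fun x => (b x : ℂ) * f x)
    ((b.hasCompactSupport.comp_left Complex.ofReal_zero).mul_right)
    ((Complex.ofRealCLM.contDiff.comp b.contDiff).mul (f.smooth ⊤))

theorem hasCompactSupport_cutoff {n : ℕ} (f : 𝓢(Rn n, ℂ)) (j : ℕ) :
    HasCompactSupport (cutoff f j) :=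
  let b : ContDiffBump (0 : Rn n) := ⟨j + 1, j + 2, by positivity, by linarith⟩
  (b.hasCompactSupport.comp_left Complex.ofReal_zero).mul_right

theorem norm_cutoff_le {n : ℕ} (f : 𝓢(Rn n, ℂ)) (j : ℕ) (x : Rn n) : ‖cutoff f j x‖ ≤ ‖f x‖ := by
  let b : ContDiffBump (0 : Rn n) := ⟨j + 1, j + 2, by positivity, by linarith⟩
  change ‖(b x : ℂ) * f x‖ ≤ _
  rw [norm_mul, Complex.norm_real, Real.norm_of_nonneg b.nonneg]
  exact mul_le_of_le_one_left (norm_nonneg _) b.le_one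

theorem cutoff_apply_of_norm_le {n : ℕ} (f : 𝓢(Rn n, ℂ)) {j : ℕ} {x : Rn n} (hx : ‖x‖ ≤ j) :
    cutoff f j x = f x := by
  let b : ContDiffBump (0 : Rn n) := ⟨j + 1, j + 2, by positivity, by linarith⟩
  change (b x : ℂ) * f x = _
  rw [b.one_of_mem_closedBall (mem_closedBall_zero_iff.2 (hx.trans (by simp [b]))),
    Complex.ofReal_one, one_mul]

/-! ### The bilinear form of the Hausdorff operator -/

namespace IsHausdorffKernel

variable {n : ℕ} [NeZero n] {Φ : Rn n → ℂ} (hΦ : IsHausdorffKernel Φ)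
include hΦ

theorem integrable_prod (f g : 𝓢(Rn n, ℂ)) :
    Integrable (fun z : Rn n × Rn n => g z.1 * (Φ z.2 * f (‖z.2‖⁻¹ • z.1)))
      (volume.prod volume) := by
  obtain ⟨A, -, hA⟩ := hΦ.exists_bound
  exact (hA f g).1

theorem hausdorffOp_apply_prod (f g : 𝓢(Rn n, ℂ)) :
    hausdorffOp hΦ f g =
      ∫ z : Rn n × Rn n, g z.1 * (Φ z.2 * f (‖z.2‖⁻¹ • z.1)) ∂(volume.prod volume) :=
  hΦ.integral_mul_hausdorffFun f g

theorem hausdorffOp_apply (f g : 𝓢(Rn n, ℂ)) :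
    hausdorffOp hΦ f g = ∫ y, Φ y * ∫ x, g x * f (‖y‖⁻¹ • x) := by
  rw [hΦ.hausdorffOp_apply_prod, integral_prod_symm _ (hΦ.integrable_prod f g)]
  refine integral_congr_ae (Eventually.of_forall fun y => ?_)
  simp only [← integral_const_mul]
  refine integral_congr_ae (Eventually.of_forall fun x => ?_)
  simp only
  ring

omit hΦ in
theorem ae_ne_zero : ∀ᵐ y : Rn n, y ≠ 0 := by
  have : Nonempty (Fin n) := ⟨0⟩
  exact Measure.ae_ne volume 0

/-- The Fourier transform intertwines `H_Φ` with its transpose. -/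
theorem hausdorffOp_apply_fourier (f W : 𝓢(Rn n, ℂ)) :
    hausdorffOp hΦ f (𝓕 W) = hausdorffOp hΦ W (𝓕 f) := by
  rw [hΦ.hausdorffOp_apply, hΦ.hausdorffOp_apply]
  refine integral_congr_ae ?_
  filter_upwards [ae_ne_zero] with y hy
  congr 1
  have hr : 0 < ‖y‖ := norm_pos_iff.2 hy
  -- For fixed y this is the identity ∫ 𝓕W · F = ∫ W · 𝓕F with F a dilate of f. The Jacobian |y|^n
  -- from 𝓕F is the one produced by the substitution x ↦ |y|x on the other side.
  have h1 := integral_fourier_mul_eq W (dilate ‖y‖⁻¹ (inv_pos.2 hr).ne' f)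
  simp only [dilate_apply, fourier_dilate_apply (inv_pos.2 hr), inv_inv, inv_pow] at h1
  rw [h1]
  have h2 := Measure.integral_comp_smul_of_nonneg volume
    (fun x : Rn n => 𝓕 f x * W (‖y‖⁻¹ • x)) ‖y‖ (hR := hr.le)
  simp only [finrank_euclideanSpace, Fintype.card_fin, Complex.real_smul, smul_smul,
    inv_mul_cancel₀ hr.ne', one_smul] at h2
  have h3 : ∫ x, 𝓕 f x * W (‖y‖⁻¹ • x) =
      ((‖y‖ ^ n : ℝ) : ℂ) * ∫ x, 𝓕 f (‖y‖ • x) * W x := by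
    rw [h2, ← mul_assoc, ← Complex.ofReal_mul, mul_inv_cancel₀ (by positivity),
      Complex.ofReal_one, one_mul]
  rw [h3, ← integral_const_mul]
  refine integral_congr_ae (Eventually.of_forall fun x => ?_)
  simp only
  ring

/-- Dominated convergence along smooth cutoffs, with the absolutely convergent double integral of f
itself as majorant. -/
theorem hausdorffOp_eq_zero_of_compactSupport
    (h : ∀ W : 𝓢(Rn n, ℂ), HasCompactSupport W → hausdorffOp hΦ W = 0) : hausdorffOp hΦ = 0 := by
  ext f g
  have hlim : Tendsto (fun j : ℕ => hausdorffOp hΦ (cutoff f j) g) atTop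
      (𝓝 (hausdorffOp hΦ f g)) := by
    simp only [hΦ.hausdorffOp_apply_prod]
    refine tendsto_integral_of_dominated_convergence _
      (fun j => (hΦ.integrable_prod (cutoff f j) g).aestronglyMeasurable)
      (hΦ.integrable_prod f g).norm (fun j => Eventually.of_forall fun z => ?_)
      (Eventually.of_forall fun z => ?_)
    · simp only [norm_mul]
      gcongr
      exact norm_cutoff_le _ _ _
    · refine tendsto_const_nhds.congr' ?_
      obtain ⟨j₀, hj₀⟩ := exists_nat_ge ‖‖z.2‖⁻¹ • z.1‖
      filter_upwards [eventually_ge_atTop j₀] with j hj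
      rw [cutoff_apply_of_norm_le f (hj₀.trans (by exact_mod_cast hj))]
  have h0 : (fun j : ℕ => hausdorffOp hΦ (cutoff f j) g) = fun _ => 0 := by
    funext j
    rw [h _ (hasCompactSupport_cutoff f j)]
    rfl
  rw [h0] at hlim
  exact tendsto_nhds_unique hlim tendsto_const_nhds

end IsHausdorffKernel

/-! ### Localisation estimates -/

/-- The integrable weight `min(1, |y|ⁿ) |Φ(y)|`. -/
def kernelWeight {n : ℕ} (Φ : Rn n → ℂ) (y : Rn n) : ℝ := min 1 (‖y‖ ^ n) * ‖Φ y‖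

theorem kernelWeight_nonneg {n : ℕ} (Φ : Rn n → ℂ) (y : Rn n) : 0 ≤ kernelWeight Φ y :=
  mul_nonneg (le_min zero_le_one (by positivity)) (norm_nonneg _)

theorem IsHausdorffKernel.aestronglyMeasurable_kernelWeight {n : ℕ} {Φ : Rn n → ℂ}
    (hΦ : IsHausdorffKernel Φ) : AEStronglyMeasurable (kernelWeight Φ) volume :=
  (Continuous.aestronglyMeasurable (by fun_prop)).mul hΦ.aestronglyMeasurable.norm

theorem IsHausdorffKernel.integrable_kernelWeight {n : ℕ} {Φ : Rn n → ℂ}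
    (hΦ : IsHausdorffKernel Φ) : Integrable (kernelWeight Φ) := by
  rw [← integrableOn_univ, ← Set.union_compl_self (Metric.ball (0 : Rn n) 1)]
  refine IntegrableOn.union ?_ ?_
  · refine hΦ.integrableOn_ball.norm.mono' hΦ.aestronglyMeasurable_kernelWeight.restrict
      (Eventually.of_forall fun y => ?_)
    rw [Real.norm_of_nonneg (kernelWeight_nonneg Φ y), norm_mul, Complex.norm_real,
      Real.norm_of_nonneg (by positivity), kernelWeight]
    gcongr
    exact min_le_right _ _
  · refine hΦ.integrableOn_compl.norm.mono' hΦ.aestronglyMeasurable_kernelWeight.restrict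
      (Eventually.of_forall fun y => ?_)
    rw [Real.norm_of_nonneg (kernelWeight_nonneg Φ y), kernelWeight]
    exact mul_le_of_le_one_left (norm_nonneg _) (min_le_left _ _)

/-- The mass that `Φ` gives to the dilations moving `a` close to `b`. -/
def concentration {n : ℕ} (Φ : Rn n → ℂ) (a b : Rn n) : ℝ :=
  ∫ y, kernelWeight Φ y * (1 + ‖b - ‖y‖ • a‖ / (1 + ‖y‖))⁻¹

theorem concentration_nonneg {n : ℕ} (Φ : Rn n → ℂ) (a b : Rn n) : 0 ≤ concentration Φ a b :=
  integral_nonneg fun y => mul_nonneg (kernelWeight_nonneg Φ y) (by positivity)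

theorem IsHausdorffKernel.integrable_concentration {n : ℕ} {Φ : Rn n → ℂ}
    (hΦ : IsHausdorffKernel Φ) (a b : Rn n) :
    Integrable fun y => kernelWeight Φ y * (1 + ‖b - ‖y‖ • a‖ / (1 + ‖y‖))⁻¹ := by
  refine hΦ.integrable_kernelWeight.mul_bdd (c := 1) ?_ (Eventually.of_forall fun y => ?_)
  · refine Measurable.aestronglyMeasurable ?_
    fun_prop
  · rw [Real.norm_of_nonneg (by positivity)]
    exact inv_le_one_of_one_le₀ (le_add_of_nonneg_right (by positivity))

/-- Since spheres are null sets, `Φ` cannot concentrate on a single dilation. -/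
theorem IsHausdorffKernel.exists_concentration_le {n : ℕ} [NeZero n] {Φ : Rn n → ℂ}
    (hΦ : IsHausdorffKernel Φ) {ε : ℝ} (hε : 0 < ε) :
    ∃ L : ℝ, ∀ a b : Rn n, L ≤ ‖a‖ + ‖b‖ → concentration Φ a b ≤ ε := by
  -- A failing sequence of pairs (a, b) with |a| + |b| → ∞ is normalised by t = |a| / (|a| + |b|) ∈
  -- [0,1], and a subsequence makes t converge. Along it | |b| - |y||a| | is (|a| + |b|) times a
  -- factor tending to |1 - t - |y|t|.
  by_contra! hcon
  choose a b hL hc using fun j : ℕ => hcon (j + 1)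
  set s : ℕ → ℝ := fun j => ‖a j‖ + ‖b j‖ with hs
  have hs0 : ∀ j, 0 < s j := fun j => lt_of_lt_of_le (by positivity) (hL j)
  have hs_top : Tendsto s atTop atTop :=
    tendsto_atTop_mono (fun j => (le_add_of_nonneg_right zero_le_one).trans (hL j))
      tendsto_natCast_atTop_atTop
  have ht : ∀ j, ‖a j‖ / s j ∈ Set.Icc (0 : ℝ) 1 := fun j =>
    ⟨by have := (hs0 j).le; positivity,
      (div_le_one (hs0 j)).2 (le_add_of_nonneg_right (norm_nonneg _))⟩
  obtain ⟨t, -, φ, hφ, htφ⟩ := isCompact_Icc.tendsto_subseq ht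
  have hlim : Tendsto (fun j => concentration Φ (a (φ j)) (b (φ j))) atTop
      (𝓝 (∫ _ : Rn n, (0 : ℝ))) := by
    refine tendsto_integral_of_dominated_convergence (kernelWeight Φ)
      (fun j => (hΦ.integrable_concentration _ _).aestronglyMeasurable)
      hΦ.integrable_kernelWeight (fun j => Eventually.of_forall fun y => ?_) ?_
    · rw [Real.norm_of_nonneg (mul_nonneg (kernelWeight_nonneg Φ y) (by positivity))]
      refine mul_le_of_le_one_right (kernelWeight_nonneg Φ y) ?_
      exact inv_le_one_of_one_le₀ (le_add_of_nonneg_right (by positivity))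
    -- The limiting factor vanishes only on the sphere of radius (1 - t)/t; for t = 0 it equals 1,
    -- so there is no exceptional set.
    · have hae : ∀ᵐ y : Rn n, 1 - t - ‖y‖ * t ≠ 0 := by
        have : Nonempty (Fin n) := ⟨0⟩
        have hnull : volume (Metric.sphere (0 : Rn n) ((1 - t) / t)) = 0 :=
          Measure.addHaar_sphere volume 0 _
        refine measure_mono_null (fun y hy => ?_) hnull
        have hy' : 1 - t - ‖y‖ * t = 0 := by simpa using hy
        have ht0 : t ≠ 0 := by
          rintro rfl
          simp at hy'
        rw [mem_sphere_zero_iff_norm, eq_div_iff ht0]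
        linarith
      filter_upwards [hae] with y hy
      rw [← mul_zero (kernelWeight Φ y)]
      refine Tendsto.const_mul _ (tendsto_inv_atTop_zero.comp (tendsto_atTop_add_const_left _ _
        (Tendsto.atTop_div_const (by positivity) ?_)))
      have hprod : Tendsto (fun j => s (φ j) *
          |1 - ‖a (φ j)‖ / s (φ j) - ‖y‖ * (‖a (φ j)‖ / s (φ j))|) atTop atTop := by
        refine Tendsto.atTop_mul_pos (abs_pos.2 hy) (hs_top.comp hφ.tendsto_atTop) ?_
        exact ((tendsto_const_nhds.sub htφ).sub (htφ.const_mul _)).abs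
      refine tendsto_atTop_mono (fun j => ?_) hprod
      have hsj := hs0 (φ j)
      calc _ = |s (φ j) * (1 - ‖a (φ j)‖ / s (φ j) - ‖y‖ * (‖a (φ j)‖ / s (φ j)))| := by
            rw [abs_mul, abs_of_pos hsj]
        _ = |‖b (φ j)‖ - ‖‖y‖ • a (φ j)‖| := by
            congr 1
            rw [norm_smul, norm_norm, mul_sub, mul_sub, mul_one, mul_div_cancel₀ _ hsj.ne',
              mul_left_comm, mul_div_cancel₀ _ hsj.ne', hs]
            ring
        _ ≤ _ := abs_norm_sub_norm_le _ _
  rw [integral_zero] at hlim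
  exact absurd (ge_of_tendsto' hlim fun j => (hc (φ j)).le) hε.not_ge

/-- `∫ (1 + |x|)^{-(n+1)} dx`. -/
def japaneseIntegral (n : ℕ) : ℝ := ∫ x : Rn n, ((1 + ‖x‖) ^ (n + 1))⁻¹

theorem integrable_japanese (n : ℕ) : Integrable fun x : Rn n => ((1 + ‖x‖) ^ (n + 1))⁻¹ := by
  have h := integrable_one_add_norm (E := Rn n) (μ := volume) (r := n + 1) (by simp)
  refine h.congr (Eventually.of_forall fun x => ?_)
  simp only
  rw [Real.rpow_neg (by positivity)]
  norm_cast

theorem japaneseIntegral_nonneg (n : ℕ) : 0 ≤ japaneseIntegral n :=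
  integral_nonneg fun x => by positivity

/-- Of the n + 2 powers of decay, one from each factor is spent on θ ≤ (1 + |t/r - a|)(1 + |t - b|),
which yields the gain θ⁻¹. The other n + 1 powers are integrable in either factor: integrating the
one centred at b gives the bound 1, the one centred at ra gives the Jacobian r^n, and together they
give the minimum. -/
theorem integral_norm_dilate_mul_norm_le {n : ℕ} {A B : Rn n → ℂ} {a b : Rn n} {C₁ C₂ : ℝ}
    (hA : ∀ t, (1 + ‖t - a‖) ^ (n + 2) * ‖A t‖ ≤ C₁)
    (hB : ∀ t, (1 + ‖t - b‖) ^ (n + 2) * ‖B t‖ ≤ C₂) {r : ℝ} (hr : 0 < r) :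
    ∫ t, ‖B t‖ * ‖A (r⁻¹ • t)‖ ≤
      C₁ * C₂ * japaneseIntegral n * (min 1 (r ^ n) * (1 + ‖b - r • a‖ / (1 + r))⁻¹) := by
  have hC₁ : 0 ≤ C₁ := le_trans (by positivity) (hA 0)
  have hC₂ : 0 ≤ C₂ := le_trans (by positivity) (hB 0)
  set θ := 1 + ‖b - r • a‖ / (1 + r) with hθ
  have hθ0 : 0 < θ := by positivity
  have hθle : ∀ t, θ ≤ (1 + ‖r⁻¹ • t - a‖) * (1 + ‖t - b‖) := by
    intro t
    have h1 : ‖b - r • a‖ ≤ ‖t - b‖ + r * ‖r⁻¹ • t - a‖ := by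
      have h2 : b - r • a = -(t - b) + r • (r⁻¹ • t - a) := by
        rw [smul_sub, smul_smul, mul_inv_cancel₀ hr.ne', one_smul]
        abel
      rw [h2]
      refine (norm_add_le _ _).trans_eq ?_
      rw [norm_neg, norm_smul, Real.norm_of_nonneg hr.le]
    have h3 : ‖b - r • a‖ / (1 + r) ≤ ‖t - b‖ + ‖r⁻¹ • t - a‖ := by
      rw [div_le_iff₀ (by positivity)]
      nlinarith [norm_nonneg (t - b), norm_nonneg (r⁻¹ • t - a)]
    nlinarith [mul_nonneg (norm_nonneg (t - b)) (norm_nonneg (r⁻¹ • t - a))]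
  have hpt : ∀ t, ‖B t‖ * ‖A (r⁻¹ • t)‖ ≤ C₁ * C₂ * θ⁻¹ *
      (((1 + ‖r⁻¹ • t - a‖) ^ (n + 1))⁻¹ * ((1 + ‖t - b‖) ^ (n + 1))⁻¹) := by
    intro t
    set u := 1 + ‖r⁻¹ • t - a‖
    set v := 1 + ‖t - b‖
    have hu : 0 < u := by positivity
    have hv : 0 < v := by positivity
    have h1 := hA (r⁻¹ • t)
    have h2 := hB t
    have h3 : θ * (u ^ (n + 1) * v ^ (n + 1)) ≤ u ^ (n + 2) * v ^ (n + 2) := by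
      calc θ * (u ^ (n + 1) * v ^ (n + 1)) ≤ (u * v) * (u ^ (n + 1) * v ^ (n + 1)) := by
            gcongr
            exact hθle t
        _ = _ := by ring
    have h4 : θ * (u ^ (n + 1) * v ^ (n + 1)) * (‖B t‖ * ‖A (r⁻¹ • t)‖) ≤ C₁ * C₂ :=
      calc _ ≤ u ^ (n + 2) * v ^ (n + 2) * (‖B t‖ * ‖A (r⁻¹ • t)‖) := by gcongr
        _ = (u ^ (n + 2) * ‖A (r⁻¹ • t)‖) * (v ^ (n + 2) * ‖B t‖) := by ring
        _ ≤ C₁ * C₂ := by gcongr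
    rw [← mul_inv, mul_assoc, ← mul_inv, ← div_eq_mul_inv, le_div_iff₀ (by positivity)]
    linarith
  have hone : ∀ c : ℝ, 0 ≤ c → ((1 + c) ^ (n + 1))⁻¹ ≤ 1 := fun c hc =>
    inv_le_one_of_one_le₀ (one_le_pow₀ (le_add_of_nonneg_right hc))
  have hIb : Integrable fun t : Rn n => ((1 + ‖t - b‖) ^ (n + 1))⁻¹ :=
    (integrable_japanese n).comp_sub_right b
  have hIa : Integrable fun t : Rn n => ((1 + ‖r⁻¹ • t - a‖) ^ (n + 1))⁻¹ :=
    ((integrable_japanese n).comp_sub_right a).comp_smul (inv_ne_zero hr.ne')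
  have hb : ∫ t, ‖B t‖ * ‖A (r⁻¹ • t)‖ ≤ C₁ * C₂ * θ⁻¹ * japaneseIntegral n := by
    calc _ ≤ ∫ t, C₁ * C₂ * θ⁻¹ * ((1 + ‖t - b‖) ^ (n + 1))⁻¹ := by
          refine integral_mono_of_nonneg (Eventually.of_forall fun t => by positivity)
            (hIb.const_mul _) (Eventually.of_forall fun t => (hpt t).trans ?_)
          have := hone _ (norm_nonneg (r⁻¹ • t - a))
          simp only
          gcongr
          exact mul_le_of_le_one_left (by positivity) this
      _ = _ := by
          rw [integral_const_mul,
            integral_sub_right_eq_self (fun t : Rn n => ((1 + ‖t‖) ^ (n + 1))⁻¹) b,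
            japaneseIntegral]
  have ha : ∫ t, ‖B t‖ * ‖A (r⁻¹ • t)‖ ≤ C₁ * C₂ * θ⁻¹ * (r ^ n * japaneseIntegral n) := by
    calc _ ≤ ∫ t, C₁ * C₂ * θ⁻¹ * ((1 + ‖r⁻¹ • t - a‖) ^ (n + 1))⁻¹ := by
          refine integral_mono_of_nonneg (Eventually.of_forall fun t => by positivity)
            (hIa.const_mul _) (Eventually.of_forall fun t => (hpt t).trans ?_)
          have := hone _ (norm_nonneg (t - b))
          simp only
          gcongr
          exact mul_le_of_le_one_right (by positivity) this
      _ = _ := by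
          rw [integral_const_mul, Measure.integral_comp_inv_smul_of_nonneg volume
            (fun t : Rn n => ((1 + ‖t - a‖) ^ (n + 1))⁻¹) hr.le,
            integral_sub_right_eq_self (fun t : Rn n => ((1 + ‖t‖) ^ (n + 1))⁻¹) a,
            japaneseIntegral]
          simp
  have hJ := japaneseIntegral_nonneg n
  rcases le_total 1 (r ^ n) with h | h
  · rw [min_eq_left h]
    linarith
  · rw [min_eq_right h]
    calc _ ≤ _ := ha
      _ = _ := by ring

theorem IsHausdorffKernel.integral_norm_le_concentration {n : ℕ} [NeZero n] {Φ : Rn n → ℂ}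
    (hΦ : IsHausdorffKernel Φ) {f g : 𝓢(Rn n, ℂ)} {a b : Rn n} {C₁ C₂ : ℝ}
    (hf : ∀ t, (1 + ‖t - a‖) ^ (n + 2) * ‖f t‖ ≤ C₁)
    (hg : ∀ t, (1 + ‖t - b‖) ^ (n + 2) * ‖g t‖ ≤ C₂) :
    ∫ z : Rn n × Rn n, ‖g z.1 * (Φ z.2 * f (‖z.2‖⁻¹ • z.1))‖ ∂(volume.prod volume) ≤
      C₁ * C₂ * japaneseIntegral n * concentration Φ a b := by
  have hInt := (hΦ.integrable_prod f g).norm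
  rw [integral_prod_symm _ hInt, concentration, ← integral_const_mul]
  refine integral_mono_ae hInt.integral_prod_right
    ((hΦ.integrable_concentration a b).const_mul _) ?_
  filter_upwards [ae_ne_zero] with y hy
  have h := integral_norm_dilate_mul_norm_le hf hg (norm_pos_iff.2 hy)
  calc ∫ x, ‖g x * (Φ y * f (‖y‖⁻¹ • x))‖ = ‖Φ y‖ * ∫ x, ‖g x‖ * ‖f (‖y‖⁻¹ • x)‖ := by
        rw [← integral_const_mul]
        refine integral_congr_ae (Eventually.of_forall fun x => ?_)
        simp only [norm_mul]
        ring
    _ ≤ ‖Φ y‖ * _ := mul_le_mul_of_nonneg_left h (norm_nonneg _)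
    _ = _ := by
        rw [kernelWeight]
        ring

theorem IsHausdorffKernel.norm_hausdorffOp_apply_le {n : ℕ} [NeZero n] {Φ : Rn n → ℂ}
    (hΦ : IsHausdorffKernel Φ) {f g : 𝓢(Rn n, ℂ)} {a b : Rn n} {C₁ C₂ : ℝ}
    (hf : ∀ t, (1 + ‖t - a‖) ^ (n + 2) * ‖f t‖ ≤ C₁)
    (hg : ∀ t, (1 + ‖t - b‖) ^ (n + 2) * ‖g t‖ ≤ C₂) :
    ‖hausdorffOp hΦ f g‖ ≤ C₁ * C₂ * japaneseIntegral n * concentration Φ a b := by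
  rw [hΦ.hausdorffOp_apply_prod]
  exact (norm_integral_le_integral_norm _).trans (hΦ.integral_norm_le_concentration hf hg)

/-! ### Test functions and representatives -/

/-- A smooth bump with support in the ball of radius `1/4`. -/
def bumpSchwartz (n : ℕ) : 𝓢(Rn n, ℂ) :=
  let b : ContDiffBump (0 : Rn n) := ⟨1 / 8, 1 / 4, by norm_num, by norm_num⟩
  HasCompactSupport.toSchwartzMap (f := fun x => (b x : ℂ))
    (b.hasCompactSupport.comp_left Complex.ofReal_zero) (Complex.ofRealCLM.contDiff.comp b.contDiff)

theorem norm_le_of_bumpSchwartz_ne_zero {n : ℕ} {ξ : Rn n} (h : bumpSchwartz n ξ ≠ 0) :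
    ‖ξ‖ ≤ 1 / 4 := by
  let b : ContDiffBump (0 : Rn n) := ⟨1 / 8, 1 / 4, by norm_num, by norm_num⟩
  have h' : (b ξ : ℂ) ≠ 0 := h
  have hmem : ξ ∈ Function.support b := by simpa using h'
  rw [b.support_eq] at hmem
  exact (mem_ball_zero_iff.1 hmem).le

theorem bumpSchwartz_zero (n : ℕ) : bumpSchwartz n 0 = 1 := by
  let b : ContDiffBump (0 : Rn n) := ⟨1 / 8, 1 / 4, by norm_num, by norm_num⟩
  change (b 0 : ℂ) = 1
  rw [b.one_of_mem_closedBall (Metric.mem_closedBall_self b.rIn_pos.le), Complex.ofReal_one]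

theorem integral_bumpSchwartz_ne_zero (n : ℕ) : ∫ ξ, bumpSchwartz n ξ ≠ 0 := by
  let b : ContDiffBump (0 : Rn n) := ⟨1 / 8, 1 / 4, by norm_num, by norm_num⟩
  change ∫ ξ, (b ξ : ℂ) ≠ 0
  rw [integral_complex_ofReal]
  exact_mod_cast (b.integral_pos (μ := volume)).ne'

theorem exists_decay_translate {n : ℕ} (f : 𝓢(Rn n, ℂ)) (m : ℕ) :
    ∃ C : ℝ, 0 ≤ C ∧ ∀ a t, (1 + ‖t - a‖) ^ m * ‖compSubConstCLM ℂ a f t‖ ≤ C := by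
  obtain ⟨C, hC, h⟩ := exists_decay f m
  exact ⟨C, hC, fun a t => by simpa using h (t - a)⟩

namespace IsHausdorffKernel

variable {n : ℕ} [NeZero n] {Φ : Rn n → ℂ} (hΦ : IsHausdorffKernel Φ)
include hΦ

omit [NeZero n] in
theorem aestronglyMeasurable_hausdorffFun (f : 𝓢(Rn n, ℂ)) :
    AEStronglyMeasurable (hausdorffFun Φ f) volume := by
  have hdil : Measurable fun z : Rn n × Rn n => f (‖z.2‖⁻¹ • z.1) :=
    f.continuous.measurable.comp (by fun_prop)
  exact (hΦ.aestronglyMeasurable.comp_snd.mul hdil.aestronglyMeasurable).integral_prod_right'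

theorem integrable_mul_hausdorffFun (f g : 𝓢(Rn n, ℂ)) :
    Integrable fun x => g x * hausdorffFun Φ f x := by
  refine (hΦ.integrable_prod f g).integral_prod_left.congr (Eventually.of_forall fun x => ?_)
  simp only [integral_const_mul, hausdorffFun]

theorem integral_norm_mul_hausdorffFun_le (f g : 𝓢(Rn n, ℂ)) :
    ∫ x, ‖g x * hausdorffFun Φ f x‖ ≤
      ∫ z : Rn n × Rn n, ‖g z.1 * (Φ z.2 * f (‖z.2‖⁻¹ • z.1))‖ ∂(volume.prod volume) := by
  have hInt := (hΦ.integrable_prod f g).norm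
  rw [integral_prod _ hInt]
  refine integral_mono (hΦ.integrable_mul_hausdorffFun f g).norm hInt.integral_prod_left
    fun x => ?_
  simp only
  rw [hausdorffFun, ← integral_const_mul]
  exact norm_integral_le_integral_norm _

omit [NeZero n] in
theorem concentration_le (a b : Rn n) : concentration Φ a b ≤ ∫ y, kernelWeight Φ y := by
  refine integral_mono (hΦ.integrable_concentration a b) hΦ.integrable_kernelWeight fun y => ?_
  refine mul_le_of_le_one_right (kernelWeight_nonneg Φ y) ?_
  exact inv_le_one_of_one_le₀ (le_add_of_nonneg_right (by positivity))

/-- `□_k H_Φ f` is the function `x ↦ ∫ H_Φ f(t) σ̂_k(t - x) dt`. -/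
theorem isGivenBy_boxOp_hausdorffOp {η : Rn n → ℝ} (hη : IsWindow η) (k : Fin n → ℤ)
    (f : 𝓢(Rn n, ℂ)) :
    IsGivenBy (boxOp η k (hausdorffOp hΦ f)) fun x =>
      hausdorffOp hΦ f (compSubConstCLM ℂ x (𝓕 (hη.partitionSchwartz k))) := by
  set K : 𝓢(Rn n, ℂ) := 𝓕 (hη.partitionSchwartz k) with hK
  obtain ⟨C₁, hC₁, hf⟩ := exists_decay_translate f (n + 2)
  obtain ⟨C₂, hC₂, hKd⟩ := exists_decay_translate K (n + 2)
  have hf0 : ∀ t, (1 + ‖t - 0‖) ^ (n + 2) * ‖f t‖ ≤ C₁ := by simpa using hf 0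
  intro G
  have hprod : Integrable (fun z : Rn n × Rn n =>
      G z.1 * (compSubConstCLM ℂ z.1 K z.2 * hausdorffFun Φ f z.2)) (volume.prod volume) := by
    have hmeas : AEStronglyMeasurable (fun z : Rn n × Rn n =>
        G z.1 * (compSubConstCLM ℂ z.1 K z.2 * hausdorffFun Φ f z.2))
        (volume.prod volume) := by
      refine AEStronglyMeasurable.mul ?_ (AEStronglyMeasurable.mul ?_ ?_)
      · exact (G.continuous.comp continuous_fst).aestronglyMeasurable
      · simp only [compSubConstCLM_apply]
        exact (K.continuous.comp (continuous_snd.sub continuous_fst)).aestronglyMeasurable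
      · exact (hΦ.aestronglyMeasurable_hausdorffFun f).comp_snd
    rw [integrable_prod_iff hmeas]
    refine ⟨Eventually.of_forall fun x =>
      (hΦ.integrable_mul_hausdorffFun f (compSubConstCLM ℂ x K)).const_mul (G x), ?_⟩
    -- The inner integral is bounded uniformly in x by the total kernel weight, so integrability of
    -- G is enough for Fubini.
    refine (G.integrable.norm.mul_const
      (C₁ * C₂ * japaneseIntegral n * ∫ y, kernelWeight Φ y)).mono'
      hmeas.norm.integral_prod_right' (Eventually.of_forall fun x => ?_)
    simp only [norm_mul (G x)]
    rw [integral_const_mul, norm_mul, norm_norm]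
    refine mul_le_mul_of_nonneg_left ?_ (norm_nonneg _)
    rw [Real.norm_of_nonneg (integral_nonneg fun _ => norm_nonneg _)]
    refine ((hΦ.integral_norm_mul_hausdorffFun_le f (compSubConstCLM ℂ x K)).trans
      (hΦ.integral_norm_le_concentration hf0 (hKd x))).trans ?_
    have := japaneseIntegral_nonneg n
    gcongr
    exact hΦ.concentration_le _ _
  have hinner : ∀ x, G x * hausdorffOp hΦ f (compSubConstCLM ℂ x K) =
      ∫ t, G x * (compSubConstCLM ℂ x K t * hausdorffFun Φ f t) := fun x => by
    rw [integral_const_mul]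
    rfl
  refine ⟨?_, ?_⟩
  · simp only [hinner]
    exact hprod.integral_prod_left
  · simp only [hinner]
    have hG : G = 𝓕 (𝓕⁻ G : 𝓢(Rn n, ℂ)) := (FourierTransform.fourier_fourierInv_eq G).symm
    conv_lhs => rw [hG, boxOp_apply_fourier]
    rw [← integral_prod _ hprod, integral_prod_symm _ hprod]
    refine integral_congr_ae (Eventually.of_forall fun t => ?_)
    have hconv := fourier_smulLeft_apply (hη.partitionSchwartz k) (𝓕⁻ G) t
    rw [FourierTransform.fourier_fourierInv_eq] at hconv
    simp only
    calc _ = (∫ s, K (t - s) * G s) * hausdorffFun Φ f t := by rw [← hconv]; rfl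
      _ = _ := by
        rw [← integral_mul_const]
        refine integral_congr_ae (Eventually.of_forall fun s => ?_)
        simp only [compSubConstCLM_apply]
        ring

end IsHausdorffKernel

/-- This is where p < 1 enters: in |h| = |h|^(1-p) |h|^p the first factor has a positive exponent
and is bounded by the supremum. -/
theorem lintegral_enorm_le_of_le {α : Type*} [MeasurableSpace α] {μ : Measure α} {h : α → ℂ}
    (hh : AEStronglyMeasurable h μ) {p : ℝ≥0∞} (hp : 0 < p) (hp1 : p < 1) {δ : ℝ≥0∞}
    (hδ : ∀ x, ‖h x‖ₑ ≤ δ) :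
    ∫⁻ x, ‖h x‖ₑ ∂μ ≤ δ ^ (1 - p.toReal) * eLpNorm h p μ ^ p.toReal := by
  have hptop : p ≠ ⊤ := (hp1.trans ENNReal.one_lt_top).ne
  have hp' : 0 < p.toReal := ENNReal.toReal_pos hp.ne' hptop
  have hp1' : p.toReal < 1 := by simpa using ENNReal.toReal_strict_mono ENNReal.one_ne_top hp1
  rw [eLpNorm_eq_lintegral_rpow_enorm_toReal hp.ne' hptop, ← ENNReal.rpow_mul,
    one_div_mul_cancel hp'.ne', ENNReal.rpow_one,
    ← lintegral_const_mul'' _ (hh.enorm.pow_const _)]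
  refine lintegral_mono fun x => ?_
  calc ‖h x‖ₑ = ‖h x‖ₑ ^ (1 - p.toReal) * ‖h x‖ₑ ^ p.toReal := by
        rw [← ENNReal.rpow_add_of_nonneg _ _ (by linarith) hp'.le, sub_add_cancel,
          ENNReal.rpow_one]
    _ ≤ _ := by
        gcongr
        exact hδ x

/-! ### The case `p < 1` -/

/-- A majorant uniform in N, for dominated convergence against `kernelWeight`. Bounding w by its
supremum gives r^n. For the bound 1, note that |x/r - Nz| < N|z|/2 forces |x/N| ≥ r|z|/2, so at each
x either g or w is in its tail; the decay factors N^(-n) and r^(-n) cancel the Jacobians of the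
other factor's integral. -/
theorem exists_norm_translate_pairing_le {n : ℕ} (g w : 𝓢(Rn n, ℂ)) {z : Rn n} (hz : z ≠ 0) :
    ∃ C : ℝ, ∀ N : ℝ, 1 ≤ N → ∀ r : ℝ, 0 < r →
      ‖∫ x, w (N⁻¹ • x) * g (r⁻¹ • x - N • z)‖ ≤ C * min 1 (r ^ n) := by
  obtain ⟨Cg, hCg, hg⟩ := exists_decay g n
  obtain ⟨Cw, hCw, hw⟩ := exists_decay w n
  have hc : 0 < ‖z‖ := norm_pos_iff.2 hz
  set c := ‖z‖ / 2 with hcdef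
  have hc2 : 0 < c := by positivity
  set Ig := ∫ x, ‖g x‖
  set Iw := ∫ x, ‖w x‖
  have hIg : 0 ≤ Ig := integral_nonneg fun _ => norm_nonneg _
  have hIw : 0 ≤ Iw := integral_nonneg fun _ => norm_nonneg _
  refine ⟨Cw * Ig + (Cw * (c ^ n)⁻¹ * Ig + Cg * (c ^ n)⁻¹ * Iw), fun N hN r hr => ?_⟩
  have hN0 : 0 < N := by linarith
  have hgi : Integrable fun x => ‖g (r⁻¹ • x - N • z)‖ :=
    (g.integrable.norm.comp_sub_right (N • z)).comp_smul (inv_ne_zero hr.ne')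
  have hwi : Integrable fun x => ‖w (N⁻¹ • x)‖ := w.integrable.norm.comp_smul (inv_ne_zero hN0.ne')
  have hgI : ∫ x, ‖g (r⁻¹ • x - N • z)‖ = r ^ n * Ig := by
    rw [Measure.integral_comp_inv_smul_of_nonneg volume (fun x => ‖g (x - N • z)‖) hr.le,
      integral_sub_right_eq_self (fun x => ‖g x‖) (N • z)]
    simp [Ig]
  have hwI : ∫ x, ‖w (N⁻¹ • x)‖ = N ^ n * Iw := by
    rw [Measure.integral_comp_inv_smul_of_nonneg volume (fun x => ‖w x‖) hN0.le]
    simp [Iw]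
  have hwb : ∀ x, ‖w x‖ ≤ Cw := fun x =>
    le_trans (le_mul_of_one_le_left (norm_nonneg _)
      (one_le_pow₀ (le_add_of_nonneg_right (norm_nonneg x)))) (hw x)
  have hdec : ∀ (f : 𝓢(Rn n, ℂ)) (C : ℝ), (∀ x, (1 + ‖x‖) ^ n * ‖f x‖ ≤ C) →
      ∀ (s : ℝ), 0 < s → ∀ x, s ≤ ‖x‖ → ‖f x‖ ≤ C * (s ^ n)⁻¹ := by
    intro f C hf s hs x hx
    rw [← div_eq_mul_inv, le_div_iff₀ (by positivity), mul_comm]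
    refine le_trans ?_ (hf x)
    gcongr
    linarith
  have hle1 : ‖∫ x, w (N⁻¹ • x) * g (r⁻¹ • x - N • z)‖ ≤ Cw * Ig * r ^ n := by
    refine (norm_integral_le_of_norm_le (hgi.const_mul Cw) (Eventually.of_forall fun x => ?_)).trans
      (le_of_eq ?_)
    · rw [norm_mul]
      gcongr
      exact hwb _
    · rw [integral_const_mul, hgI]
      ring
  have hle2 : ‖∫ x, w (N⁻¹ • x) * g (r⁻¹ • x - N • z)‖ ≤
      Cw * (c ^ n)⁻¹ * Ig + Cg * (c ^ n)⁻¹ * Iw := by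
    refine (norm_integral_le_of_norm_le ((hgi.const_mul (Cw * ((r * c) ^ n)⁻¹)).add
      (hwi.const_mul (Cg * ((N * c) ^ n)⁻¹))) (Eventually.of_forall fun x => ?_)).trans
      (le_of_eq ?_)
    · rw [norm_mul]
      simp only [Pi.add_apply]
      rcases le_total (N * c) ‖r⁻¹ • x - N • z‖ with h | h
      · have := hdec g Cg hg _ (by positivity) _ h
        calc _ ≤ ‖w (N⁻¹ • x)‖ * (Cg * ((N * c) ^ n)⁻¹) := by gcongr
          _ = Cg * ((N * c) ^ n)⁻¹ * ‖w (N⁻¹ • x)‖ := mul_comm _ _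
          _ ≤ _ := le_add_of_nonneg_left (by positivity)
      · have hx : r * c ≤ ‖N⁻¹ • x‖ := by
          have h1 : N * ‖z‖ ≤ ‖r⁻¹ • x‖ + ‖r⁻¹ • x - N • z‖ := by
            have := norm_le_norm_add_norm_sub (r⁻¹ • x) (N • z)
            rwa [norm_smul N, Real.norm_of_nonneg hN0.le] at this
          rw [norm_smul, Real.norm_of_nonneg (by positivity)] at h1 ⊢
          have h2 : N * c ≤ r⁻¹ * ‖x‖ := by
            have : N * ‖z‖ = N * c + N * c := by rw [hcdef]; ring
            linarith
          rw [inv_mul_eq_div, le_div_iff₀ hr] at h2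
          rw [inv_mul_eq_div, le_div_iff₀ hN0]
          linarith
        have := hdec w Cw hw _ (by positivity) _ hx
        calc _ ≤ (Cw * ((r * c) ^ n)⁻¹) * ‖g (r⁻¹ • x - N • z)‖ := by gcongr
          _ ≤ _ := le_add_of_nonneg_right (by positivity)
    · simp only [Pi.add_apply]
      rw [integral_add (hgi.const_mul _) (hwi.const_mul _), integral_const_mul,
        integral_const_mul, hgI, hwI, mul_pow, mul_pow]
      field_simp
  have hA : 0 ≤ Cw * Ig := by positivity
  have hB : 0 ≤ Cw * (c ^ n)⁻¹ * Ig + Cg * (c ^ n)⁻¹ * Iw := by positivity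
  rcases le_total 1 (r ^ n) with h | h
  · rw [min_eq_left h]
    linarith
  · rw [min_eq_right h]
    refine hle1.trans ?_
    gcongr
    linarith

/-- The substitution x = r(u + Nz) moves all dependence on N into w, whose argument (r/N)u + rz
tends to rz. -/
theorem integral_translate_pairing_eq {n : ℕ} (g w : 𝓢(Rn n, ℂ)) (z : Rn n) {N r : ℝ}
    (hN : 0 < N) (hr : 0 < r) :
    ∫ x, w (N⁻¹ • x) * g (r⁻¹ • x - N • z) =
      ((r ^ n : ℝ) : ℂ) * ∫ u, w ((r * N⁻¹) • u + r • z) * g u := by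
  have h := Measure.integral_comp_inv_smul_of_nonneg volume
    (fun x : Rn n => w ((r * N⁻¹) • x) * g (x - N • z)) hr.le
  simp only [finrank_euclideanSpace, Fintype.card_fin, Complex.real_smul, smul_smul] at h
  rw [← integral_sub_right_eq_self (fun u => w ((r * N⁻¹) • u + r • z) * g u) (N • z)]
  simp only [smul_sub, smul_smul, inv_mul_cancel_right₀ hN.ne', sub_add_cancel]
  rw [← h]
  refine integral_congr_ae (Eventually.of_forall fun x => ?_)
  have : r * N⁻¹ * r⁻¹ = N⁻¹ := by field_simp
  simp only [this]

theorem tendsto_integral_translate_pairing {n : ℕ} (g w : 𝓢(Rn n, ℂ)) (z : Rn n) {r : ℝ}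
    (hr : 0 < r) :
    Tendsto (fun j : ℕ => ∫ x, w ((j + 1 : ℝ)⁻¹ • x) * g (r⁻¹ • x - (j + 1 : ℝ) • z)) atTop
      (𝓝 (((r ^ n : ℝ) : ℂ) * (w (r • z) * ∫ u, g u))) := by
  simp only [fun j : ℕ => integral_translate_pairing_eq g w z (N := j + 1) (by positivity) hr]
  refine Tendsto.const_mul _ ?_
  rw [← integral_const_mul]
  refine tendsto_integral_of_dominated_convergence
    (fun u => SchwartzMap.seminorm ℂ 0 0 w * ‖g u‖) (fun j => ?_) (g.integrable.norm.const_mul _)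
    (fun j => Eventually.of_forall fun u => ?_) (Eventually.of_forall fun u => ?_)
  · exact ((w.continuous.comp (by fun_prop)).mul g.continuous).aestronglyMeasurable
  · rw [norm_mul]
    gcongr
    exact norm_le_seminorm ℂ w _
  · refine Tendsto.mul_const _ ((w.continuous.tendsto _).comp ?_)
    have h1 : Tendsto (fun j : ℕ => r * (j + 1 : ℝ)⁻¹) atTop (𝓝 (r * 0)) :=
      Tendsto.const_mul _
        (by simpa [one_div] using tendsto_one_div_add_atTop_nhds_zero_nat (𝕜 := ℝ))
    have h2 := (h1.smul_const u).add_const (r • z)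
    simpa using h2

namespace IsHausdorffKernel

variable {n : ℕ} [NeZero n] {Φ : Rn n → ℂ} (hΦ : IsHausdorffKernel Φ)
include hΦ

theorem tendsto_hausdorffOp_translate (g w : 𝓢(Rn n, ℂ)) {z : Rn n} (hz : z ≠ 0) :
    Tendsto (fun j : ℕ => hausdorffOp hΦ (compSubConstCLM ℂ ((j + 1 : ℝ) • z) g)
      (dilate (j + 1 : ℝ)⁻¹ (by positivity) w)) atTop
      (𝓝 (∫ y, Φ y * (((‖y‖ ^ n : ℝ) : ℂ) * (w (‖y‖ • z) * ∫ u, g u)))) := by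
  obtain ⟨C, hC⟩ := exists_norm_translate_pairing_le g w hz
  simp only [hΦ.hausdorffOp_apply, dilate_apply, compSubConstCLM_apply]
  refine tendsto_integral_filter_of_dominated_convergence (fun y => C * kernelWeight Φ y)
    (Eventually.of_forall fun j => ?_) (Eventually.of_forall fun j => ?_)
    (hΦ.integrable_kernelWeight.const_mul C) ?_
  · have h := (hΦ.integrable_prod (compSubConstCLM ℂ ((j + 1 : ℝ) • z) g)
      (dilate (j + 1 : ℝ)⁻¹ (by positivity) w)).integral_prod_right.aestronglyMeasurable
    refine h.congr (Eventually.of_forall fun y => ?_)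
    simp only [dilate_apply, compSubConstCLM_apply]
    rw [← integral_const_mul]
    refine integral_congr_ae (Eventually.of_forall fun x => ?_)
    simp only
    ring
  · filter_upwards [ae_ne_zero] with y hy
    rw [norm_mul, kernelWeight, ← mul_assoc, mul_comm ‖Φ y‖]
    gcongr
    exact hC _ (by simp) _ (norm_pos_iff.2 hy)
  · filter_upwards [ae_ne_zero] with y hy
    exact (tendsto_integral_translate_pairing g w z (norm_pos_iff.2 hy)).const_mul _

/-- If `∫ Φ(y) |y|ⁿ w(|y| z) dy = 0` for all `z ≠ 0`, then `H_Φ f` annihilates `w`. -/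
theorem hausdorffOp_apply_eq_zero_of_transpose {w : 𝓢(Rn n, ℂ)}
    (hw : ∀ z, z ≠ 0 → ∫ y, Φ y * (((‖y‖ ^ n : ℝ) : ℂ) * w (‖y‖ • z)) = 0) (f : 𝓢(Rn n, ℂ)) :
    hausdorffOp hΦ f w = 0 := by
  have hsub : ∀ (F : Rn n → ℂ) (y : Rn n), y ≠ 0 →
      ∫ x, F x = ((‖y‖ ^ n : ℝ) : ℂ) * ∫ x, F (‖y‖ • x) := fun F y hy => by
    have hr : 0 < ‖y‖ := norm_pos_iff.2 hy
    rw [Measure.integral_comp_smul_of_nonneg volume F ‖y‖ (hR := hr.le)]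
    simp only [finrank_euclideanSpace, Fintype.card_fin, Complex.real_smul]
    rw [← mul_assoc, ← Complex.ofReal_mul, mul_inv_cancel₀ (by positivity), Complex.ofReal_one,
      one_mul]
  have hsubR : ∀ (F : Rn n → ℝ) (y : Rn n), y ≠ 0 →
      ∫ x, F x = ‖y‖ ^ n * ∫ x, F (‖y‖ • x) := fun F y hy => by
    have hr : 0 < ‖y‖ := norm_pos_iff.2 hy
    rw [Measure.integral_comp_smul_of_nonneg volume F ‖y‖ (hR := hr.le)]
    simp only [finrank_euclideanSpace, Fintype.card_fin, smul_eq_mul]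
    rw [← mul_assoc, mul_inv_cancel₀ (by positivity), one_mul]
  have hcancel : ∀ y : Rn n, y ≠ 0 → ∀ x : Rn n, ‖y‖⁻¹ • ‖y‖ • x = x := fun y hy x => by
    rw [smul_smul, inv_mul_cancel₀ (norm_ne_zero_iff.2 hy), one_smul]
  have hInt : Integrable (fun v : Rn n × Rn n =>
      f v.1 * (Φ v.2 * (((‖v.2‖ ^ n : ℝ) : ℂ) * w (‖v.2‖ • v.1)))) (volume.prod volume) := by
    have hmeas : AEStronglyMeasurable (fun v : Rn n × Rn n =>
        f v.1 * (Φ v.2 * (((‖v.2‖ ^ n : ℝ) : ℂ) * w (‖v.2‖ • v.1)))) (volume.prod volume) := by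
      refine AEStronglyMeasurable.mul ?_ (AEStronglyMeasurable.mul hΦ.aestronglyMeasurable.comp_snd
        (AEStronglyMeasurable.mul ?_ ?_))
      · exact (f.continuous.comp continuous_fst).aestronglyMeasurable
      · exact Continuous.aestronglyMeasurable (by fun_prop)
      · exact (w.continuous.comp (by fun_prop)).aestronglyMeasurable
    rw [integrable_prod_iff' hmeas]
    constructor
    · refine Eventually.of_forall fun y => ?_
      refine f.integrable.mul_bdd (c := ‖Φ y‖ * (‖y‖ ^ n * SchwartzMap.seminorm ℂ 0 0 w)) ?_
        (Eventually.of_forall fun x => ?_)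
      · have hcont : Continuous fun x : Rn n => w (‖y‖ • x) :=
          w.continuous.comp (continuous_const_smul _)
        simp only
        exact (hcont.aestronglyMeasurable.const_mul _).const_mul _
      · simp only [norm_mul, Complex.norm_real, norm_pow, norm_norm]
        gcongr
        exact norm_le_seminorm ℂ w _
    -- After the substitution x ↦ |y|x on each slice, this is the double integral already known to
    -- converge absolutely.
    · refine (hΦ.integrable_prod f w).norm.integral_prod_right.congr ?_
      filter_upwards [ae_ne_zero] with y hy
      rw [hsubR _ y hy, ← integral_const_mul]
      refine integral_congr_ae (Eventually.of_forall fun x => ?_)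
      simp only [hcancel y hy, norm_mul, Complex.norm_real, norm_pow, norm_norm]
      ring
  calc hausdorffOp hΦ f w = ∫ y, ∫ x, f x * (Φ y * (((‖y‖ ^ n : ℝ) : ℂ) * w (‖y‖ • x))) := by
        rw [hΦ.hausdorffOp_apply]
        refine integral_congr_ae ?_
        filter_upwards [ae_ne_zero] with y hy
        rw [hsub _ y hy, ← integral_const_mul, ← integral_const_mul]
        refine integral_congr_ae (Eventually.of_forall fun x => ?_)
        simp only [hcancel y hy]
        ring
    _ = ∫ x, ∫ y, f x * (Φ y * (((‖y‖ ^ n : ℝ) : ℂ) * w (‖y‖ • x))) := by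
        rw [← integral_prod_symm _ hInt, integral_prod _ hInt]
    _ = ∫ _ : Rn n, (0 : ℂ) := by
        refine integral_congr_ae ?_
        filter_upwards [ae_ne_zero] with x hx
        rw [integral_const_mul, hw x hx, mul_zero]
    _ = 0 := integral_zero _ _

end IsHausdorffKernel

/-! ### Translated test functions: bounded quasi-norm against vanishing supremum. -/

theorem eLpNorm_compSubConst {n : ℕ} (f : 𝓢(Rn n, ℂ)) (a : Rn n) (p : ℝ≥0∞) :
    eLpNorm (compSubConstCLM ℂ a f) p volume = eLpNorm f p volume :=
  eLpNorm_comp_measurePreserving (g := (f : Rn n → ℂ)) f.continuous.aestronglyMeasurable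
    (measurePreserving_sub_right volume a)

@[simp] theorem latticePoint_zero (n : ℕ) : (latticePoint 0 : Rn n) = 0 := by
  ext i
  simp

theorem fourier_dilate_eq {n : ℕ} {N : ℝ} (hN : 0 < N) (W : 𝓢(Rn n, ℂ)) :
    𝓕 (((N ^ n : ℝ) : ℂ) • dilate N hN.ne' W) = dilate N⁻¹ (inv_pos.2 hN).ne' (𝓕 W) := by
  ext ξ
  rw [FourierTransform.fourier_smul, smul_apply, fourier_dilate_apply hN, dilate_apply,
    smul_eq_mul, ← mul_assoc, ← Complex.ofReal_mul, mul_inv_cancel₀ (by positivity),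
    Complex.ofReal_one, one_mul]

/-- Slowly varying band-limited test functions only see `□_0`. -/
theorem IsWindow.boxOp_zero_apply_dilate {n : ℕ} {η : Rn n → ℝ} (hη : IsWindow η)
    (u : 𝓢'(Rn n, ℂ)) {W : 𝓢(Rn n, ℂ)} {R : ℝ} (hR : ∀ ξ, W ξ ≠ 0 → ‖ξ‖ ≤ R) {N : ℝ}
    (hN : 0 < N) (hRN : 4 * R ≤ N) :
    boxOp η 0 u (dilate N⁻¹ (inv_pos.2 hN).ne' (𝓕 W)) =
      u (dilate N⁻¹ (inv_pos.2 hN).ne' (𝓕 W)) := by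
  rw [← fourier_dilate_eq hN, boxOp_apply_fourier]
  congr 2
  ext ξ
  rw [smulLeftCLM_apply_apply (hη.hasTemperateGrowth_partitionFun 0)]
  by_cases hξ : W (N • ξ) = 0
  · simp [hξ]
  -- On the support N|ξ| ≤ R ≤ N/4, hence |ξ| ≤ 1/4, where σ_0 = 1.
  · have h1 := hR _ hξ
    rw [norm_smul, Real.norm_of_nonneg hN.le] at h1
    have h3 : ‖ξ - latticePoint 0‖ ≤ 1 / 4 := by
      rw [latticePoint_zero, sub_zero]
      by_contra! hcon
      nlinarith
    simp [hη.partitionFun_eq_one h3]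

theorem _root_.HasCompactSupport.exists_norm_le {E F : Type*} [NormedAddCommGroup E]
    [NormedAddCommGroup F] {f : E → F} (hf : HasCompactSupport f) :
    ∃ R : ℝ, ∀ x, f x ≠ 0 → ‖x‖ ≤ R := by
  obtain ⟨R, hR⟩ := hf.isCompact.isBounded.subset_closedBall 0
  exact ⟨R, fun x hx => mem_closedBall_zero_iff.1 (hR (subset_tsupport f hx))⟩

theorem _root_.ENNReal.tendsto_atTop_zero_of_real {δ : ℕ → ℝ≥0∞}
    (h : ∀ ε : ℝ, 0 < ε → ∀ᶠ j in atTop, δ j ≤ ENNReal.ofReal ε) : Tendsto δ atTop (𝓝 0) := by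
  rw [ENNReal.tendsto_nhds_zero]
  intro ε hε
  obtain ⟨ε', h0, h1⟩ := ENNReal.lt_iff_exists_nnreal_btwn.1 hε
  filter_upwards [h ε' (by exact_mod_cast h0)] with j hj
  exact hj.trans (by simpa using h1.le)

theorem _root_.ENNReal.tendsto_const_mul_rpow_mul_const {δ : ℕ → ℝ≥0∞} (hδ : Tendsto δ atTop (𝓝 0))
    {s : ℝ} (hs : 0 < s) {B M : ℝ≥0∞} (hB : B ≠ ⊤) (hM : M ≠ ⊤) :
    Tendsto (fun j => B * (δ j ^ s * M)) atTop (𝓝 0) := by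
  have h1 : Tendsto (fun j => δ j ^ s) atTop (𝓝 0) := by
    have h2 := (ENNReal.continuous_rpow_const (y := s)).tendsto 0
    rw [ENNReal.zero_rpow_of_pos hs] at h2
    exact h2.comp hδ
  have h3 := ENNReal.Tendsto.mul_const h1 (b := M) (Or.inr hM)
  have h4 := ENNReal.Tendsto.const_mul h3 (a := B) (Or.inr hB)
  simpa using h4

namespace IsHausdorffKernel

variable {n : ℕ} [NeZero n] {Φ : Rn n → ℂ} (hΦ : IsHausdorffKernel Φ)
include hΦ

/-- `H_Φ` pairs functions localised far from the origin weakly with all other localised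
functions. -/
theorem exists_norm_hausdorffOp_apply_le {C₁ C₂ ε : ℝ} (hε : 0 < ε) :
    ∃ L : ℝ, ∀ (f g : 𝓢(Rn n, ℂ)) (a b : Rn n),
      (∀ t, (1 + ‖t - a‖) ^ (n + 2) * ‖f t‖ ≤ C₁) →
      (∀ t, (1 + ‖t - b‖) ^ (n + 2) * ‖g t‖ ≤ C₂) →
      L ≤ ‖a‖ + ‖b‖ → ‖hausdorffOp hΦ f g‖ ≤ ε := by
  set A := C₁ * C₂ * japaneseIntegral n with hA
  obtain ⟨L, hL⟩ := hΦ.exists_concentration_le (ε := ε / (|A| + 1)) (by positivity)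
  refine ⟨L, fun f g a b hf hg hab => ?_⟩
  calc ‖hausdorffOp hΦ f g‖ ≤ A * concentration Φ a b := hΦ.norm_hausdorffOp_apply_le hf hg
    _ ≤ |A| * (ε / (|A| + 1)) :=
        mul_le_mul (le_abs_self A) (hL _ _ hab) (concentration_nonneg Φ a b) (abs_nonneg A)
    _ ≤ ε := by
        rw [mul_div_assoc', div_le_iff₀ (by positivity)]
        nlinarith [abs_nonneg A]

/-- The centre (j + 1)z of the first function escapes to infinity, and the localisation bound then
holds wherever the second centre x lies. -/
theorem tendsto_iSup_enorm_hausdorffOp_translate (g K : 𝓢(Rn n, ℂ)) {z : Rn n} (hz : z ≠ 0) :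
    Tendsto (fun j : ℕ => ⨆ x, ‖hausdorffOp hΦ (compSubConstCLM ℂ ((j + 1 : ℝ) • z) g)
      (compSubConstCLM ℂ x K)‖ₑ) atTop (𝓝 0) := by
  obtain ⟨C₁, -, hg⟩ := exists_decay_translate g (n + 2)
  obtain ⟨C₂, -, hK⟩ := exists_decay_translate K (n + 2)
  refine ENNReal.tendsto_atTop_zero_of_real fun ε hε => ?_
  obtain ⟨L, hL⟩ := hΦ.exists_norm_hausdorffOp_apply_le (C₁ := C₁) (C₂ := C₂) hε
  obtain ⟨j₀, hj₀⟩ := exists_nat_ge (L / ‖z‖)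
  filter_upwards [eventually_ge_atTop j₀] with j hj
  refine iSup_le fun x => ?_
  rw [← ofReal_norm]
  refine ENNReal.ofReal_le_ofReal (hL _ _ _ _ (hg _) (hK x) ?_)
  have hz0 : 0 < ‖z‖ := norm_pos_iff.2 hz
  rw [norm_smul, Real.norm_of_nonneg (by positivity)]
  rw [div_le_iff₀ hz0] at hj₀
  have : (j₀ : ℝ) ≤ j := by exact_mod_cast hj
  nlinarith [norm_nonneg x]

/-- The bound is independent of `a`: translation changes neither the L^p norm nor the modulus of the
Fourier transform, and a single block is at most the whole ℓ^q norm. -/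
theorem distLpNorm_box_translate_le {η : Rn n → ℝ} (hη : IsWindow η) {p q : ℝ≥0∞} (hq : 0 < q)
    {C : ℝ≥0} (hC : ∀ f : 𝓢(Rn n, ℂ), modulationNorm η p q (hausdorffOp hΦ f) ≤
      C * modulationNorm η p q (toTemperedDistributionCLM (Rn n) ℂ volume f)) (a : Rn n) :
    distLpNorm p (boxOp η 0 (hausdorffOp hΦ (compSubConstCLM ℂ a (𝓕⁻ (bumpSchwartz n))))) ≤
      C * eLpNorm (𝓕⁻ (bumpSchwartz n) : 𝓢(Rn n, ℂ)) p volume := by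
  set g : 𝓢(Rn n, ℂ) := 𝓕⁻ (bumpSchwartz n) with hg
  have hFg : 𝓕 g = bumpSchwartz n := FourierTransform.fourier_fourierInv_eq _
  refine (le_lqNorm hq (fun k => distLpNorm p
    (boxOp η k (hausdorffOp hΦ (compSubConstCLM ℂ a g)))) 0).trans ?_
  refine (hC (compSubConstCLM ℂ a g)).trans ?_
  rw [← eLpNorm_compSubConst g a p]
  gcongr
  refine hη.modulationNorm_le_of_fourier_support p hq 0 _ fun ξ hξ => ?_
  rw [latticePoint_zero, sub_zero]
  refine norm_le_of_bumpSchwartz_ne_zero ?_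
  rw [← norm_ne_zero_iff, ← hFg, ← norm_fourier_compSubConst_apply g a]
  exact norm_ne_zero_iff.2 hξ

theorem enorm_hausdorffOp_dilate_le {η : Rn n → ℝ} (hη : IsWindow η) {p : ℝ≥0∞} (hp : 0 < p)
    (hp1 : p < 1) (f : 𝓢(Rn n, ℂ)) {W : 𝓢(Rn n, ℂ)} {R : ℝ} (hR : ∀ ξ, W ξ ≠ 0 → ‖ξ‖ ≤ R) {N : ℝ}
    (hN : 0 < N) (hRN : 4 * R ≤ N) :
    ‖hausdorffOp hΦ f (dilate N⁻¹ (inv_pos.2 hN).ne' (𝓕 W))‖ₑ ≤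
      ENNReal.ofReal (SchwartzMap.seminorm ℂ 0 0 (𝓕 W)) *
        ((⨆ x, ‖hausdorffOp hΦ f (compSubConstCLM ℂ x (𝓕 (hη.partitionSchwartz 0)))‖ₑ) ^
            (1 - p.toReal) *
          distLpNorm p (boxOp η 0 (hausdorffOp hΦ f)) ^ p.toReal) := by
  have hgiven := hΦ.isGivenBy_boxOp_hausdorffOp hη 0 f
  set h : Rn n → ℂ := fun x =>
    hausdorffOp hΦ f (compSubConstCLM ℂ x (𝓕 (hη.partitionSchwartz 0)))
  rw [hgiven.distLpNorm_eq p, ← hη.boxOp_zero_apply_dilate _ hR hN hRN, (hgiven _).2]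
  calc _ ≤ ∫⁻ x, ‖dilate N⁻¹ (inv_pos.2 hN).ne' (𝓕 W) x * h x‖ₑ :=
        enorm_integral_le_lintegral_enorm _
    _ ≤ ∫⁻ x, ENNReal.ofReal (SchwartzMap.seminorm ℂ 0 0 (𝓕 W)) * ‖h x‖ₑ := by
        refine lintegral_mono fun x => ?_
        rw [enorm_mul, dilate_apply]
        gcongr
        rw [← ofReal_norm]
        exact ENNReal.ofReal_le_ofReal (norm_le_seminorm ℂ (𝓕 W) _)
    _ = ENNReal.ofReal (SchwartzMap.seminorm ℂ 0 0 (𝓕 W)) * ∫⁻ x, ‖h x‖ₑ :=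
        lintegral_const_mul' _ _ ENNReal.ofReal_ne_top
    _ ≤ _ := by
        gcongr
        exact lintegral_enorm_le_of_le hgiven.locallyIntegrable.aestronglyMeasurable hp hp1
          fun x => le_iSup (fun x => ‖h x‖ₑ) x

omit [NeZero n] hΦ in
theorem integral_fourierInv_bumpSchwartz :
    ∫ u, (𝓕⁻ (bumpSchwartz n) : 𝓢(Rn n, ℂ)) u = 1 := by
  have hF : 𝓕 (𝓕⁻ (bumpSchwartz n) : 𝓢(Rn n, ℂ)) = bumpSchwartz n :=
    FourierTransform.fourier_fourierInv_eq _
  have h := bumpSchwartz_zero n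
  rw [← hF, fourier_coe, Real.fourier_eq] at h
  simpa using h

/-- Moving the Fourier transform across H_Φ pairs H_Φ W with 𝓕f, and every Schwartz function has
this form. -/
theorem hausdorffOp_eq_zero_of_apply_fourier {W : 𝓢(Rn n, ℂ)}
    (h : ∀ f : 𝓢(Rn n, ℂ), hausdorffOp hΦ f (𝓕 W) = 0) : hausdorffOp hΦ W = 0 := by
  ext G
  have h1 := h (𝓕⁻ G)
  rw [hΦ.hausdorffOp_apply_fourier, FourierTransform.fourier_fourierInv_eq] at h1
  exact h1

theorem tendsto_hausdorffOp_translate_zero {η : Rn n → ℝ} (hη : IsWindow η) {p q : ℝ≥0∞}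
    (hp : 0 < p) (hp1 : p < 1) (hq : 0 < q)
    (hb : IsBoundedOnModulation η p q (hausdorffOp hΦ)) {W : 𝓢(Rn n, ℂ)}
    (hW : HasCompactSupport W) {z : Rn n} (hz : z ≠ 0) :
    Tendsto (fun j : ℕ => hausdorffOp hΦ
      (compSubConstCLM ℂ ((j + 1 : ℝ) • z) (𝓕⁻ (bumpSchwartz n)))
      (dilate (j + 1 : ℝ)⁻¹ (by positivity) (𝓕 W))) atTop (𝓝 0) := by
  obtain ⟨C, hC⟩ := hb
  obtain ⟨R, hR⟩ := hW.exists_norm_le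
  have hp1' : p.toReal < 1 := by simpa using ENNReal.toReal_strict_mono ENNReal.one_ne_top hp1
  have hMtop : C * eLpNorm (𝓕⁻ (bumpSchwartz n) : 𝓢(Rn n, ℂ)) p volume ≠ ⊤ :=
    ENNReal.mul_ne_top ENNReal.coe_ne_top (SchwartzMap.memLp _ p volume).eLpNorm_ne_top
  rw [tendsto_zero_iff_enorm_tendsto_zero]
  have hupper := ENNReal.tendsto_const_mul_rpow_mul_const
    (hΦ.tendsto_iSup_enorm_hausdorffOp_translate (𝓕⁻ (bumpSchwartz n))
      (𝓕 (hη.partitionSchwartz 0)) hz) (s := 1 - p.toReal) (by linarith)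
    (B := ENNReal.ofReal (SchwartzMap.seminorm ℂ 0 0 (𝓕 W))) ENNReal.ofReal_ne_top
    (ENNReal.rpow_ne_top_of_nonneg (y := p.toReal) ENNReal.toReal_nonneg hMtop)
  refine tendsto_of_tendsto_of_tendsto_of_le_of_le' tendsto_const_nhds hupper
    (Eventually.of_forall fun _ => zero_le) ?_
  obtain ⟨j₀, hj₀⟩ := exists_nat_ge (4 * R)
  filter_upwards [eventually_ge_atTop j₀] with j hj
  have hj' : (j₀ : ℝ) ≤ j := by exact_mod_cast hj
  refine (hΦ.enorm_hausdorffOp_dilate_le hη hp hp1 _ hR (N := j + 1) (by positivity)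
    (by linarith)).trans ?_
  gcongr
  exact hΦ.distLpNorm_box_translate_le hη hq hC _

theorem eq_zero_of_isBounded_of_lt_one_left {η : Rn n → ℝ} (hη : IsWindow η) {p q : ℝ≥0∞}
    (hp : 0 < p) (hp1 : p < 1) (hq : 0 < q)
    (hb : IsBoundedOnModulation η p q (hausdorffOp hΦ)) : hausdorffOp hΦ = 0 := by
  refine hΦ.hausdorffOp_eq_zero_of_compactSupport fun W hW =>
    hΦ.hausdorffOp_eq_zero_of_apply_fourier <|
      hΦ.hausdorffOp_apply_eq_zero_of_transpose fun z hz => ?_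
  have hlim := tendsto_nhds_unique
    (hΦ.tendsto_hausdorffOp_translate (𝓕⁻ (bumpSchwartz n)) (𝓕 W) hz)
    (hΦ.tendsto_hausdorffOp_translate_zero hη hp hp1 hq hb hW hz)
  rw [integral_fourierInv_bumpSchwartz] at hlim
  simpa only [mul_one] using hlim

end IsHausdorffKernel

/-! ### The case `q < 1 ≤ p` -/

theorem integrable_weight_mul_norm {n : ℕ} (w : 𝓢(Rn n, ℂ)) (k : ℕ) :
    Integrable fun s => (1 + ‖s‖) ^ k * ‖w s‖ := by
  obtain ⟨C, hC, hw⟩ := exists_decay w (k + (n + 1))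
  refine ((integrable_japanese n).const_mul C).mono' ?_ (Eventually.of_forall fun s => ?_)
  · have := w.continuous
    exact Continuous.aestronglyMeasurable (by fun_prop)
  · rw [Real.norm_of_nonneg (by positivity), ← div_eq_mul_inv, le_div_iff₀ (by positivity)]
    calc _ = (1 + ‖s‖) ^ (k + (n + 1)) * ‖w s‖ := by ring
      _ ≤ C := hw s

/-- The transform of W(·/N) is N^n 𝓕W(N·): its L¹ norm is fixed, and its mass moves towards the
origin, where the weight is smaller. -/
theorem integral_weight_mul_norm_fourier_dilate_le {n : ℕ} (W : 𝓢(Rn n, ℂ)) (k : ℕ) {N : ℝ}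
    (hN : 1 ≤ N) (hN0 : N⁻¹ ≠ 0) :
    ∫ s, (1 + ‖s‖) ^ k * ‖𝓕 (dilate N⁻¹ hN0 W) s‖ ≤ ∫ s, (1 + ‖s‖) ^ k * ‖𝓕 W s‖ := by
  have hNpos : 0 < N := by linarith
  have h := Measure.integral_comp_smul_of_nonneg volume
    (fun s : Rn n => (1 + ‖N⁻¹ • s‖) ^ k * ‖𝓕 W s‖) N (hR := hNpos.le)
  simp only [finrank_euclideanSpace, Fintype.card_fin, smul_smul, inv_mul_cancel₀ hNpos.ne',
    one_smul, smul_eq_mul] at h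
  calc ∫ s, (1 + ‖s‖) ^ k * ‖𝓕 (dilate N⁻¹ hN0 W) s‖
      = ∫ s, N ^ n * ((1 + ‖s‖) ^ k * ‖𝓕 W (N • s)‖) := by
        refine integral_congr_ae (Eventually.of_forall fun s => ?_)
        simp only [fourier_dilate_apply (inv_pos.2 hNpos), inv_pow, inv_inv, norm_mul,
          Complex.norm_real, norm_pow, Real.norm_of_nonneg hNpos.le]
        ring
    _ = ∫ s, (1 + ‖N⁻¹ • s‖) ^ k * ‖𝓕 W s‖ := by
        rw [integral_const_mul, h, ← mul_assoc, mul_inv_cancel₀ (by positivity), one_mul]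
    _ ≤ _ := by
        refine integral_mono_of_nonneg (Eventually.of_forall fun s => by positivity)
          (integrable_weight_mul_norm (𝓕 W) k) (Eventually.of_forall fun s => ?_)
        simp only
        gcongr
        rw [norm_smul, Real.norm_of_nonneg (by positivity)]
        exact mul_le_of_le_one_left (norm_nonneg _) (inv_le_one_of_one_le₀ hN)

/-- The Fourier transforms of unit-scale pieces of slowly varying functions are uniformly bounded
in every Lebesgue space. -/
theorem exists_eLpNorm_fourier_piece_le {n : ℕ} (χ W : 𝓢(Rn n, ℂ)) (p' : ℝ≥0∞) :
    ∃ B : ℝ≥0∞, B ≠ 0 ∧ B ≠ ⊤ ∧ ∀ (a : Rn n) (N : ℝ) (hN0 : N⁻¹ ≠ 0), 1 ≤ N →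
      eLpNorm (𝓕 (smulLeftCLM ℂ (compSubConstCLM ℂ a χ) (dilate N⁻¹ hN0 W)) : 𝓢(Rn n, ℂ))
        p' volume ≤ B := by
  obtain ⟨k, hk⟩ := Measure.HasTemperateGrowth.exists_eLpNorm_lt_top p'
    (μ := (volume : Measure (Rn n))) inferInstance
  obtain ⟨C, hC, hχ⟩ := exists_decay (𝓕 χ) k
  set I := ∫ s, (1 + ‖s‖) ^ k * ‖𝓕 W s‖ with hI
  have hI0 : 0 ≤ I := integral_nonneg fun s => by positivity
  -- The summand 1 only serves to make the constant nonzero, as the Hölder step requires.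
  refine ⟨ENNReal.ofReal (C * I) * eLpNorm (fun x : Rn n => (1 + ‖x‖) ^ (-k : ℝ)) p' volume + 1,
    by simp, by finiteness, fun a N hN0 hN => ?_⟩
  refine le_trans ?_ le_self_add
  refine eLpNorm_le_mul_eLpNorm_of_ae_le_mul (Eventually.of_forall fun x => ?_) p'
  rw [Real.norm_of_nonneg (by positivity), Real.rpow_neg (by positivity), Real.rpow_natCast,
    ← div_eq_mul_inv, le_div_iff₀ (by positivity), mul_comm, fourier_smulLeft_apply]
  set V := dilate N⁻¹ hN0 W with hV
  have hpt : ∀ s, (1 + ‖x‖) ^ k * ‖𝓕 (compSubConstCLM ℂ a χ) (x - s) * 𝓕 V s‖ ≤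
      C * ((1 + ‖s‖) ^ k * ‖𝓕 V s‖) := by
    intro s
    rw [norm_mul, norm_fourier_compSubConst_apply]
    -- Submultiplicativity of the weight shares it between the two factors of the convolution.
    -- Translating χ does not change the modulus of its transform, so the bound is uniform in a.
    have h1 : (1 + ‖x‖) ≤ (1 + ‖x - s‖) * (1 + ‖s‖) := by
      have := norm_le_norm_sub_add x s
      nlinarith [mul_nonneg (norm_nonneg (x - s)) (norm_nonneg s)]
    calc _ ≤ ((1 + ‖x - s‖) * (1 + ‖s‖)) ^ k * (‖𝓕 χ (x - s)‖ * ‖𝓕 V s‖) := by gcongr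
      _ = ((1 + ‖x - s‖) ^ k * ‖𝓕 χ (x - s)‖) * ((1 + ‖s‖) ^ k * ‖𝓕 V s‖) := by
          rw [mul_pow]
          ring
      _ ≤ _ := by
          gcongr
          exact hχ _
  calc (1 + ‖x‖) ^ k * ‖∫ s, 𝓕 (compSubConstCLM ℂ a χ) (x - s) * 𝓕 V s‖
      ≤ (1 + ‖x‖) ^ k * ∫ s, ‖𝓕 (compSubConstCLM ℂ a χ) (x - s) * 𝓕 V s‖ := by
        gcongr
        exact norm_integral_le_integral_norm _
    _ = ∫ s, (1 + ‖x‖) ^ k * ‖𝓕 (compSubConstCLM ℂ a χ) (x - s) * 𝓕 V s‖ :=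
        (integral_const_mul _ _).symm
    _ ≤ ∫ s, C * ((1 + ‖s‖) ^ k * ‖𝓕 V s‖) :=
        integral_mono_of_nonneg (Eventually.of_forall fun s => by positivity)
          ((integrable_weight_mul_norm (𝓕 V) k).const_mul C) (Eventually.of_forall hpt)
    _ = C * ∫ s, (1 + ‖s‖) ^ k * ‖𝓕 V s‖ := integral_const_mul _ _
    _ ≤ C * I := by
        gcongr
        exact integral_weight_mul_norm_fourier_dilate_le W k hN hN0

/-- A smooth bump equal to `1` on the ball of radius `n`. -/
def wideBump (n : ℕ) : 𝓢(Rn n, ℂ) :=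
  let b : ContDiffBump (0 : Rn n) := ⟨n + 1, n + 2, by positivity, by linarith⟩
  HasCompactSupport.toSchwartzMap (f := fun x => (b x : ℂ))
    (b.hasCompactSupport.comp_left Complex.ofReal_zero) (Complex.ofRealCLM.contDiff.comp b.contDiff)

theorem wideBump_eq_one {n : ℕ} {ξ : Rn n} (h : ‖ξ‖ ≤ n) : wideBump n ξ = 1 := by
  let b : ContDiffBump (0 : Rn n) := ⟨n + 1, n + 2, by positivity, by linarith⟩
  change (b ξ : ℂ) = 1
  rw [b.one_of_mem_closedBall (mem_closedBall_zero_iff.2 (h.trans (by simp [b]))),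
    Complex.ofReal_one]

/-! ### Recovering a pairing from its frequency blocks. -/

namespace IsWindow

variable {n : ℕ} {η : Rn n → ℝ} (hη : IsWindow η)
include hη

/-- The bump is 1 on the support of σ_k. Inserting it replaces 𝓕V, whose dual norm may grow with the
scale of V, by a unit-scale piece whose dual norm stays bounded. -/
theorem boxOp_apply_fourier_localize (k : Fin n → ℤ) (u : 𝓢'(Rn n, ℂ)) (V : 𝓢(Rn n, ℂ)) :
    boxOp η k u (𝓕 V) =
      boxOp η k u (𝓕 (smulLeftCLM ℂ (compSubConstCLM ℂ (latticePoint k) (wideBump n)) V)) := by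
  rw [boxOp_apply_fourier, boxOp_apply_fourier]
  congr 2
  ext ξ
  rw [smulLeftCLM_apply_apply (hη.hasTemperateGrowth_partitionFun k),
    smulLeftCLM_apply_apply (hη.hasTemperateGrowth_partitionFun k),
    smulLeftCLM_apply_apply (hasTemperateGrowth _), compSubConstCLM_apply]
  by_cases h : partitionFun η k ξ = 0
  · simp [h]
  · rw [wideBump_eq_one (hη.norm_sub_le_of_partitionFun_ne_zero h), one_smul]

/-- A test function with compact Fourier support only sees finitely many of the `□_k`. -/
theorem exists_finset_sum_boxOp_apply {V : 𝓢(Rn n, ℂ)} (hV : HasCompactSupport V) :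
    ∃ S : Finset (Fin n → ℤ), ∀ u : 𝓢'(Rn n, ℂ), u (𝓕 V) = ∑ k ∈ S, boxOp η k u (𝓕 V) := by
  obtain ⟨R, hR⟩ := hV.exists_norm_le
  refine ⟨(finite_lattice_near (0 : Rn n) (R + 1)).toFinset, fun u => ?_⟩
  set S := (finite_lattice_near (0 : Rn n) (R + 1)).toFinset with hS
  have hsum : ∑ k ∈ S, boxOp η k u (𝓕 V) =
      TemperedDistribution.fourierMultiplierCLM ℂ
        (fun ξ => ∑ k ∈ S, (partitionFun η k ξ : ℂ)) u (𝓕 V) := by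
    rw [TemperedDistribution.fourierMultiplierCLM_sum ℂ
      (fun k _ => hη.hasTemperateGrowth_partitionFun k)]
    simp [boxOp]
  rw [hsum, TemperedDistribution.fourierMultiplierCLM_apply_apply,
    FourierTransform.fourierInv_fourier_eq]
  congr 2
  ext ξ
  rw [smulLeftCLM_apply_apply (Function.HasTemperateGrowth.sum
    fun k _ => hη.hasTemperateGrowth_partitionFun k)]
  by_cases h : V ξ = 0
  · simp [h]
  · have hone : ∑ k ∈ S, partitionFun η k ξ = 1 := by
      rw [← hη.tsum_partitionFun ξ, tsum_eq_sum]
      intro k hk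
      by_contra hne
      refine hk ((Set.Finite.mem_toFinset _).2 fun i => ?_)
      have h1 := abs_lt.1 (hη.abs_sub_lt_of_partitionFun_ne_zero hne i)
      have h2 := abs_le.1 ((abs_apply_le_norm ξ i).trans (hR ξ h))
      simp only [PiLp.zero_apply, zero_sub, abs_neg]
      rw [abs_le]
      constructor <;> linarith
    rw [← Complex.ofReal_sum, hone, Complex.ofReal_one, one_smul]

/-- This is where q < 1 enters: Σ a_k ≤ (sup a)^(1-q) Σ a_k^q, and Hölder's inequality bounds each
a_k by B times the L^p norm of the block. -/
theorem enorm_apply_fourier_le {p p' q : ℝ≥0∞} [p.HolderConjugate p'] (hq : 0 < q) (hq1 : q < 1)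
    (u : 𝓢'(Rn n, ℂ)) {V : 𝓢(Rn n, ℂ)} (hV : HasCompactSupport V) {B : ℝ≥0∞} (hB0 : B ≠ 0)
    (hBtop : B ≠ ⊤)
    (hB : ∀ a, eLpNorm (𝓕 (smulLeftCLM ℂ (compSubConstCLM ℂ a (wideBump n)) V) : 𝓢(Rn n, ℂ))
      p' volume ≤ B) :
    ‖u (𝓕 V)‖ₑ ≤ (⨆ k, ‖boxOp η k u (𝓕 V)‖ₑ) ^ (1 - q.toReal) *
      (B * modulationNorm η p q u) ^ q.toReal := by
  have hqtop : q ≠ ⊤ := (hq1.trans ENNReal.one_lt_top).ne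
  have hq' : 0 < q.toReal := ENNReal.toReal_pos hq.ne' hqtop
  have hq1' : q.toReal < 1 := by simpa using ENNReal.toReal_strict_mono ENNReal.one_ne_top hq1
  obtain ⟨S, hS⟩ := hη.exists_finset_sum_boxOp_apply hV
  set a : (Fin n → ℤ) → ℝ≥0∞ := fun k => ‖boxOp η k u (𝓕 V)‖ₑ with ha
  have hbound : ∀ k, a k ≤ distLpNorm p (boxOp η k u) * B := fun k => by
    simp only [ha]
    rw [hη.boxOp_apply_fourier_localize]
    exact enorm_apply_le_distLpNorm_mul (p' := p') _ _ (hB _) hB0 hBtop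
  calc ‖u (𝓕 V)‖ₑ ≤ ∑ k ∈ S, a k := by
        rw [hS u]
        exact enorm_sum_le _ _
    _ ≤ ∑ k ∈ S, (⨆ k, a k) ^ (1 - q.toReal) * (B ^ q.toReal *
          distLpNorm p (boxOp η k u) ^ q.toReal) := by
        refine Finset.sum_le_sum fun k _ => ?_
        calc a k = a k ^ (1 - q.toReal) * a k ^ q.toReal := by
              rw [← ENNReal.rpow_add_of_nonneg _ _ (by linarith) hq'.le, sub_add_cancel,
                ENNReal.rpow_one]
          _ ≤ _ := by
              rw [← ENNReal.mul_rpow_of_nonneg _ _ hq'.le, mul_comm B]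
              exact mul_le_mul' (ENNReal.rpow_le_rpow (le_iSup a k) (by linarith))
                (ENNReal.rpow_le_rpow (hbound k) hq'.le)
    _ = (⨆ k, a k) ^ (1 - q.toReal) * (B ^ q.toReal *
          ∑ k ∈ S, distLpNorm p (boxOp η k u) ^ q.toReal) := by
        rw [Finset.mul_sum, Finset.mul_sum]
    _ ≤ _ := by
        rw [ENNReal.mul_rpow_of_nonneg _ _ hq'.le]
        gcongr
        exact sum_rpow_le_lqNorm_rpow hq hqtop (fun k => distLpNorm p (boxOp η k u)) S

end IsWindow

/-! ### Modulated test functions and lattice frequencies escaping to infinity. -/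

theorem norm_fourierInv_compSubConst_apply {n : ℕ} (f : 𝓢(Rn n, ℂ)) (a x : Rn n) :
    ‖𝓕⁻ (compSubConstCLM ℂ a f) x‖ = ‖𝓕⁻ f x‖ := by
  have hneg : ∀ g : 𝓢(Rn n, ℂ), 𝓕⁻ g x = 𝓕 g (-x) := fun g => by
    rw [fourier_coe, fourierInv_coe, Real.fourierInv_eq_fourier_neg]
  rw [hneg, hneg, norm_fourier_compSubConst_apply]

theorem hasCompactSupport_dilate {n : ℕ} {W : 𝓢(Rn n, ℂ)} (hW : HasCompactSupport W) (c : ℝ)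
    (hc : c ≠ 0) : HasCompactSupport (dilate c hc W) := by
  have h : HasCompactSupport fun x : Rn n => W (c • x) := HasCompactSupport.comp_smul hW hc
  exact h

theorem IsHausdorffKernel.hausdorffOp_apply_eq_fourier {n : ℕ} [NeZero n] {Φ : Rn n → ℂ}
    (hΦ : IsHausdorffKernel Φ) (V F : 𝓢(Rn n, ℂ)) :
    hausdorffOp hΦ V F = hausdorffOp hΦ (𝓕⁻ F) (𝓕 V) := by
  rw [hΦ.hausdorffOp_apply_fourier, FourierTransform.fourier_fourierInv_eq]

/-- The lattice points `⌊N z⌋`. -/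
def latticeFloor {n : ℕ} (z : Rn n) (N : ℝ) : Fin n → ℤ := fun i => ⌊N * z i⌋

theorem norm_latticeFloor_sub_le {n : ℕ} (z : Rn n) (N : ℝ) :
    ‖latticePoint (latticeFloor z N) - N • z‖ ≤ n := by
  refine norm_le_of_forall_abs_le_one fun i => ?_
  have h1 := Int.floor_le (N * z i)
  have h2 := Int.lt_floor_add_one (N * z i)
  simp only [PiLp.sub_apply, latticePoint_apply, latticeFloor, PiLp.smul_apply, smul_eq_mul]
  rw [abs_le]
  constructor <;> linarith

theorem tendsto_inv_smul_latticeFloor {n : ℕ} (z v : Rn n) :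
    Tendsto (fun j : ℕ => (j + 1 : ℝ)⁻¹ • (v + latticePoint (latticeFloor z (j + 1)))) atTop
      (𝓝 z) := by
  rw [tendsto_iff_norm_sub_tendsto_zero]
  have hinv : Tendsto (fun j : ℕ => (j + 1 : ℝ)⁻¹ * (‖v‖ + n)) atTop (𝓝 0) := by
    have h := tendsto_one_div_add_atTop_nhds_zero_nat (𝕜 := ℝ)
    simpa [one_div] using h.mul_const (‖v‖ + n)
  refine squeeze_zero (fun _ => norm_nonneg _) (fun j => ?_) hinv
  have hj : (0 : ℝ) < j + 1 := by positivity
  have heq : (j + 1 : ℝ)⁻¹ • (v + latticePoint (latticeFloor z (j + 1))) - z =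
      (j + 1 : ℝ)⁻¹ • (v + (latticePoint (latticeFloor z (j + 1)) - (j + 1 : ℝ) • z)) := by
    rw [smul_add, smul_add, smul_sub, smul_smul, inv_mul_cancel₀ hj.ne', one_smul, add_sub_assoc]
  rw [heq, norm_smul, Real.norm_of_nonneg (by positivity)]
  gcongr
  exact (norm_add_le _ _).trans (by gcongr; exact norm_latticeFloor_sub_le z _)

theorem tendsto_norm_latticeFloor {n : ℕ} {z : Rn n} (hz : z ≠ 0) :
    Tendsto (fun j : ℕ => ‖latticePoint (latticeFloor z (j + 1))‖) atTop atTop := by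
  have hz0 : 0 < ‖z‖ := norm_pos_iff.2 hz
  have h1 : Tendsto (fun j : ℕ => (j + 1 : ℝ) * ‖z‖ - n) atTop atTop :=
    tendsto_atTop_add_const_right _ _ ((tendsto_atTop_add_const_right _ _
      tendsto_natCast_atTop_atTop).atTop_mul_const hz0)
  refine tendsto_atTop_mono (fun j => ?_) h1
  have h2 := norm_latticeFloor_sub_le z (j + 1)
  have h3 := norm_le_norm_add_norm_sub (latticePoint (latticeFloor z (j + 1))) ((j + 1 : ℝ) • z)
  rw [norm_smul, Real.norm_of_nonneg (by positivity)] at h3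
  linarith

/-- The majorant for dominated convergence in this case. The translated bump lives where x/N is
close to z, hence away from the origin; at x/(Nr) the boundedness of W gives 1 and its decay gives
r^n. -/
theorem exists_norm_modulate_pairing_le {n : ℕ} (W : 𝓢(Rn n, ℂ)) {z : Rn n} (hz : z ≠ 0) :
    ∃ C : ℝ, ∀ᶠ j : ℕ in atTop, ∀ r : ℝ, 0 < r →
      ‖∫ x, compSubConstCLM ℂ (latticePoint (latticeFloor z (j + 1))) (bumpSchwartz n) x *
        W ((j + 1 : ℝ)⁻¹ • r⁻¹ • x)‖ ≤ C * min 1 (r ^ n) := by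
  obtain ⟨D, hD, hW⟩ := exists_decay W n
  have hz0 : 0 < ‖z‖ := norm_pos_iff.2 hz
  -- Rounding to the lattice and the width of the bump each cost at most c of |z| = 4c, so |x/N| ≥
  -- 2c remains.
  set c := ‖z‖ / 4 with hc
  have hc0 : 0 < c := by positivity
  set I := ∫ x, ‖bumpSchwartz n x‖ with hI
  have hI0 : 0 ≤ I := integral_nonneg fun _ => norm_nonneg _
  refine ⟨D * (1 + (c ^ n)⁻¹) * I, ?_⟩
  have hnear := (tendsto_inv_smul_latticeFloor z 0).eventually (Metric.ball_mem_nhds z hc0)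
  have hsmall : ∀ᶠ j : ℕ in atTop, (j + 1 : ℝ)⁻¹ < c := by
    have h := tendsto_one_div_add_atTop_nhds_zero_nat (𝕜 := ℝ)
    simp only [one_div] at h
    exact h.eventually (gt_mem_nhds hc0)
  filter_upwards [hnear, hsmall] with j hj1 hj2 r hr
  set k := latticePoint (latticeFloor z (j + 1)) with hk
  have hj : (0 : ℝ) < j + 1 := by positivity
  have hpt : ∀ x, ‖compSubConstCLM ℂ k (bumpSchwartz n) x * W ((j + 1 : ℝ)⁻¹ • r⁻¹ • x)‖ ≤
      D * (1 + (c ^ n)⁻¹) * min 1 (r ^ n) * ‖bumpSchwartz n (x - k)‖ := by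
    intro x
    rw [norm_mul, compSubConstCLM_apply, mul_comm]
    by_cases h0 : bumpSchwartz n (x - k) = 0
    · simp [h0]
    gcongr
    have hx := norm_le_of_bumpSchwartz_ne_zero h0
    have hfar : c ≤ ‖(j + 1 : ℝ)⁻¹ • x‖ := by
      rw [dist_eq_norm, zero_add] at hj1
      have h1 : ‖(j + 1 : ℝ)⁻¹ • (x - k)‖ ≤ c := by
        rw [norm_smul, Real.norm_of_nonneg (by positivity)]
        nlinarith [norm_nonneg (x - k)]
      have h2 : z = (j + 1 : ℝ)⁻¹ • x - (j + 1 : ℝ)⁻¹ • (x - k) - ((j + 1 : ℝ)⁻¹ • k - z) := by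
        rw [smul_sub]
        abel
      have h3 : ‖z‖ ≤ ‖(j + 1 : ℝ)⁻¹ • x‖ + ‖(j + 1 : ℝ)⁻¹ • (x - k)‖ +
          ‖(j + 1 : ℝ)⁻¹ • k - z‖ := by
        conv_lhs => rw [h2]
        refine (norm_sub_le _ _).trans ?_
        gcongr
        exact norm_sub_le _ _
      have h4 : ‖z‖ = 4 * c := by rw [hc]; ring
      linarith
    set v := (j + 1 : ℝ)⁻¹ • r⁻¹ • x with hv
    have hvn : c / r ≤ ‖v‖ := by
      rw [hv, smul_comm, norm_smul, Real.norm_of_nonneg (by positivity), div_eq_inv_mul]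
      gcongr
    have hWv := hW v
    rcases le_total 1 (r ^ n) with h | h
    · rw [min_eq_left h, mul_one]
      have h1 : (1 : ℝ) ≤ (1 + ‖v‖) ^ n := one_le_pow₀ (le_add_of_nonneg_right (norm_nonneg v))
      have h2 : 0 ≤ D * (c ^ n)⁻¹ := by positivity
      nlinarith [norm_nonneg (W v)]
    · rw [min_eq_right h]
      have h1 : (c / r) ^ n ≤ (1 + ‖v‖) ^ n := by
        gcongr
        linarith
      have h2 : (c / r) ^ n * ‖W v‖ ≤ D := le_trans (by gcongr) hWv
      rw [div_pow, div_mul_eq_mul_div, div_le_iff₀ (by positivity)] at h2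
      have h3 : ‖W v‖ ≤ D * r ^ n / c ^ n := by
        rw [le_div_iff₀ (by positivity)]
        linarith
      have h4 : 0 ≤ D * r ^ n := by positivity
      calc _ ≤ _ := h3
        _ = D * (c ^ n)⁻¹ * r ^ n := by ring
        _ ≤ _ := by nlinarith
  refine (norm_integral_le_of_norm_le
    (((bumpSchwartz n).integrable.norm.comp_sub_right k).const_mul _)
    (Eventually.of_forall hpt)).trans (le_of_eq ?_)
  rw [integral_const_mul, integral_sub_right_eq_self (fun x => ‖bumpSchwartz n x‖) k]
  ring

theorem tendsto_integral_modulate_pairing {n : ℕ} (W : 𝓢(Rn n, ℂ)) (z : Rn n) (r : ℝ) :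
    Tendsto (fun j : ℕ => ∫ x, compSubConstCLM ℂ (latticePoint (latticeFloor z (j + 1)))
      (bumpSchwartz n) x * W ((j + 1 : ℝ)⁻¹ • r⁻¹ • x)) atTop
      (𝓝 ((∫ x, bumpSchwartz n x) * W (r⁻¹ • z))) := by
  have hshift : ∀ j : ℕ, ∫ x, compSubConstCLM ℂ (latticePoint (latticeFloor z (j + 1)))
      (bumpSchwartz n) x * W ((j + 1 : ℝ)⁻¹ • r⁻¹ • x) =
      ∫ x, bumpSchwartz n x *
        W (r⁻¹ • (j + 1 : ℝ)⁻¹ • (x + latticePoint (latticeFloor z (j + 1)))) := fun j => by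
    rw [← integral_add_right_eq_self _ (latticePoint (latticeFloor z (j + 1)))]
    refine integral_congr_ae (Eventually.of_forall fun x => ?_)
    simp only [compSubConstCLM_apply, add_sub_cancel_right]
    rw [smul_comm]
  simp only [hshift]
  rw [← integral_mul_const]
  refine tendsto_integral_of_dominated_convergence
    (fun x => ‖bumpSchwartz n x‖ * SchwartzMap.seminorm ℂ 0 0 W) (fun j => ?_)
    ((bumpSchwartz n).integrable.norm.mul_const _) (fun j => Eventually.of_forall fun x => ?_)
    (Eventually.of_forall fun x => ?_)
  · exact ((bumpSchwartz n).continuous.mul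
      (W.continuous.comp (by fun_prop))).aestronglyMeasurable
  · rw [norm_mul]
    gcongr
    exact norm_le_seminorm ℂ W _
  · exact ((W.continuous.tendsto _).comp
      ((tendsto_inv_smul_latticeFloor z x).const_smul r⁻¹)).const_mul _

/-! ### The two limits of the modulated pairing, and the conclusion for `q < 1`. -/

namespace IsHausdorffKernel

variable {n : ℕ} [NeZero n] {Φ : Rn n → ℂ} (hΦ : IsHausdorffKernel Φ)
include hΦ

theorem tendsto_hausdorffOp_modulate (W : 𝓢(Rn n, ℂ)) {z : Rn n} (hz : z ≠ 0) :
    Tendsto (fun j : ℕ => hausdorffOp hΦ (dilate (j + 1 : ℝ)⁻¹ (by positivity) W)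
      (compSubConstCLM ℂ (latticePoint (latticeFloor z (j + 1))) (bumpSchwartz n))) atTop
      (𝓝 ((∫ x, bumpSchwartz n x) * hausdorffFun Φ W z)) := by
  obtain ⟨C, hC⟩ := exists_norm_modulate_pairing_le W hz
  have hlim : (∫ x, bumpSchwartz n x) * hausdorffFun Φ W z =
      ∫ y, Φ y * ((∫ x, bumpSchwartz n x) * W (‖y‖⁻¹ • z)) := by
    rw [hausdorffFun, ← integral_const_mul]
    refine integral_congr_ae (Eventually.of_forall fun y => ?_)
    simp only
    ring
  rw [hlim]
  simp only [hΦ.hausdorffOp_apply, dilate_apply]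
  refine tendsto_integral_filter_of_dominated_convergence (fun y => C * kernelWeight Φ y)
    (Eventually.of_forall fun j => ?_) ?_ (hΦ.integrable_kernelWeight.const_mul C) ?_
  · have h := (hΦ.integrable_prod (dilate (j + 1 : ℝ)⁻¹ (by positivity) W)
      (compSubConstCLM ℂ (latticePoint (latticeFloor z (j + 1)))
        (bumpSchwartz n))).integral_prod_right.aestronglyMeasurable
    refine h.congr (Eventually.of_forall fun y => ?_)
    simp only [dilate_apply]
    rw [← integral_const_mul]
    refine integral_congr_ae (Eventually.of_forall fun x => ?_)
    simp only
    ring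
  · filter_upwards [hC] with j hj
    filter_upwards [ae_ne_zero] with y hy
    rw [norm_mul, kernelWeight, ← mul_assoc, mul_comm ‖Φ y‖]
    gcongr
    exact hj _ (norm_pos_iff.2 hy)
  · exact Eventually.of_forall fun y =>
      (tendsto_integral_modulate_pairing W z ‖y‖).const_mul _

theorem hausdorffOp_eq_zero_of_hausdorffFun {W : 𝓢(Rn n, ℂ)}
    (h : ∀ z, z ≠ 0 → hausdorffFun Φ W z = 0) : hausdorffOp hΦ W = 0 := by
  ext g
  change ∫ x, g x * hausdorffFun Φ W x = 0
  rw [← integral_zero (Rn n) ℂ (μ := volume)]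
  refine integral_congr_ae ?_
  filter_upwards [ae_ne_zero] with x hx
  rw [h x hx, mul_zero]

omit [NeZero n] hΦ in
-- Since σ_k is at most 1 and lives within distance n of k, the decay constant depends neither on k
-- nor on the dilation.
theorem weight_mul_norm_partition_dilate_le {η : Rn n → ℝ} (hη : IsWindow η) (k : Fin n → ℤ)
    (W : 𝓢(Rn n, ℂ)) (N : ℝ) (hN : N ≠ 0) (t : Rn n) :
    (1 + ‖t - latticePoint k‖) ^ (n + 2) *
      ‖smulLeftCLM ℂ (fun ξ => (partitionFun η k ξ : ℂ)) (dilate N hN W) t‖ ≤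
      (1 + n) ^ (n + 2) * SchwartzMap.seminorm ℂ 0 0 W := by
  rw [smulLeftCLM_apply_apply (hη.hasTemperateGrowth_partitionFun k), dilate_apply, norm_smul,
    Complex.norm_real, Real.norm_of_nonneg (hη.partitionFun_nonneg k t)]
  by_cases h : partitionFun η k t = 0
  · rw [h]
    simp only [zero_mul, mul_zero]
    positivity
  · have h1 := hη.norm_sub_le_of_partitionFun_ne_zero h
    have h2 : partitionFun η k t * ‖W (N • t)‖ ≤ SchwartzMap.seminorm ℂ 0 0 W :=
      (mul_le_of_le_one_left (norm_nonneg _) (hη.partitionFun_le_one k t)).trans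
        (norm_le_seminorm ℂ W _)
    exact mul_le_mul (by gcongr) h2 (mul_nonneg (hη.partitionFun_nonneg k t) (norm_nonneg _))
      (by positivity)

/-- Transposing □_k and the Fourier transform pairs H_Φ(σ_k V), localised at k, with a bump centred
at ⌊Nz⌋. That centre tends to infinity, which suffices for every k at once. -/
theorem tendsto_iSup_enorm_boxOp_modulate {η : Rn n → ℝ} (hη : IsWindow η) (W : 𝓢(Rn n, ℂ))
    {z : Rn n} (hz : z ≠ 0) :
    Tendsto (fun j : ℕ => ⨆ k, ‖boxOp η k (hausdorffOp hΦ
      (𝓕⁻ (compSubConstCLM ℂ (latticePoint (latticeFloor z (j + 1))) (bumpSchwartz n))))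
      (𝓕 (dilate (j + 1 : ℝ)⁻¹ (by positivity) W))‖ₑ) atTop (𝓝 0) := by
  obtain ⟨C₂, -, hγ⟩ := exists_decay_translate (bumpSchwartz n) (n + 2)
  refine ENNReal.tendsto_atTop_zero_of_real fun ε hε => ?_
  obtain ⟨L, hL⟩ := hΦ.exists_norm_hausdorffOp_apply_le
    (C₁ := (1 + n) ^ (n + 2) * SchwartzMap.seminorm ℂ 0 0 W) (C₂ := C₂) hε
  filter_upwards [(tendsto_norm_latticeFloor hz).eventually_ge_atTop L] with j hj
  refine iSup_le fun k => ?_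
  rw [boxOp_apply_fourier, hΦ.hausdorffOp_apply_fourier,
    FourierTransform.fourier_fourierInv_eq, ← ofReal_norm]
  refine ENNReal.ofReal_le_ofReal (hL _ _ _ _
    (weight_mul_norm_partition_dilate_le hη k W _ _) (hγ _) ?_)
  exact hj.trans (le_add_of_nonneg_left (norm_nonneg _))

omit [NeZero n] hΦ in
theorem modulationNorm_modulate_le {η : Rn n → ℝ} (hη : IsWindow η) (p : ℝ≥0∞) {q : ℝ≥0∞}
    (hq : 0 < q) (k : Fin n → ℤ) :
    modulationNorm η p q (toTemperedDistributionCLM (Rn n) ℂ volume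
      (𝓕⁻ (compSubConstCLM ℂ (latticePoint k) (bumpSchwartz n)))) ≤
      eLpNorm (𝓕⁻ (bumpSchwartz n) : 𝓢(Rn n, ℂ)) p volume := by
  refine (hη.modulationNorm_le_of_fourier_support p hq k _ fun ξ hξ => ?_).trans_eq ?_
  · rw [FourierTransform.fourier_fourierInv_eq, compSubConstCLM_apply] at hξ
    exact norm_le_of_bumpSchwartz_ne_zero hξ
  · exact eLpNorm_congr_norm_ae
      (Eventually.of_forall fun x => norm_fourierInv_compSubConst_apply _ _ x)

theorem tendsto_hausdorffOp_modulate_zero {η : Rn n → ℝ} (hη : IsWindow η) {p q : ℝ≥0∞}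
    (hp : 1 ≤ p) (hq : 0 < q) (hq1 : q < 1)
    (hb : IsBoundedOnModulation η p q (hausdorffOp hΦ)) {W : 𝓢(Rn n, ℂ)}
    (hW : HasCompactSupport W) {z : Rn n} (hz : z ≠ 0) :
    Tendsto (fun j : ℕ => hausdorffOp hΦ (dilate (j + 1 : ℝ)⁻¹ (by positivity) W)
      (compSubConstCLM ℂ (latticePoint (latticeFloor z (j + 1))) (bumpSchwartz n))) atTop
      (𝓝 0) := by
  obtain ⟨C, hC⟩ := hb
  have hconj : p.HolderConjugate p.conjExponent := .conjExponent hp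
  obtain ⟨B, hB0, hBtop, hB⟩ := exists_eLpNorm_fourier_piece_le (wideBump n) W p.conjExponent
  have hq1' : q.toReal < 1 := by simpa using ENNReal.toReal_strict_mono ENNReal.one_ne_top hq1
  have hg := (SchwartzMap.memLp (𝓕⁻ (bumpSchwartz n) : 𝓢(Rn n, ℂ)) p volume).eLpNorm_ne_top
  have hMtop : B * (C * eLpNorm (𝓕⁻ (bumpSchwartz n) : 𝓢(Rn n, ℂ)) p volume) ≠ ⊤ :=
    ENNReal.mul_ne_top hBtop (ENNReal.mul_ne_top ENNReal.coe_ne_top hg)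
  rw [tendsto_zero_iff_enorm_tendsto_zero]
  have hupper := ENNReal.tendsto_const_mul_rpow_mul_const
    (hΦ.tendsto_iSup_enorm_boxOp_modulate hη W hz) (s := 1 - q.toReal) (by linarith)
    (B := 1) ENNReal.one_ne_top
    (ENNReal.rpow_ne_top_of_nonneg (y := q.toReal) ENNReal.toReal_nonneg hMtop)
  refine tendsto_of_tendsto_of_tendsto_of_le_of_le tendsto_const_nhds hupper
    (fun _ => zero_le) fun j => ?_
  have hj : (0 : ℝ) < j + 1 := by positivity
  set V := dilate (j + 1 : ℝ)⁻¹ (by positivity) W with hV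
  set F : 𝓢(Rn n, ℂ) :=
    compSubConstCLM ℂ (latticePoint (latticeFloor z (j + 1))) (bumpSchwartz n) with hF
  have hVc : HasCompactSupport V := hasCompactSupport_dilate hW _ _
  simp only [one_mul]
  rw [hΦ.hausdorffOp_apply_eq_fourier]
  refine (hη.enorm_apply_fourier_le (p := p) (p' := p.conjExponent) hq hq1 _ hVc hB0 hBtop
    fun a => hB a _ _ (by linarith [(Nat.cast_nonneg j : (0 : ℝ) ≤ j)])).trans ?_
  gcongr
  exact (hC _).trans (by gcongr; exact modulationNorm_modulate_le hη p hq _)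

theorem eq_zero_of_isBounded_of_lt_one_right {η : Rn n → ℝ} (hη : IsWindow η) {p q : ℝ≥0∞}
    (hp : 1 ≤ p) (hq : 0 < q) (hq1 : q < 1)
    (hb : IsBoundedOnModulation η p q (hausdorffOp hΦ)) : hausdorffOp hΦ = 0 := by
  refine hΦ.hausdorffOp_eq_zero_of_compactSupport fun W hW =>
    hΦ.hausdorffOp_eq_zero_of_hausdorffFun fun z hz => ?_
  have hlim := tendsto_nhds_unique (hΦ.tendsto_hausdorffOp_modulate W hz)
    (hΦ.tendsto_hausdorffOp_modulate_zero hη hp hq hq1 hb hW hz)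
  exact (mul_eq_zero.1 hlim).resolve_left (integral_bumpSchwartz_ne_zero n)

end IsHausdorffKernel

/-! ### Both notions of boundedness -/

theorem HasBoundedExtension.isBoundedOnModulation {n : ℕ} {η : Rn n → ℝ} {p q : ℝ≥0∞}
    {H : 𝓢(Rn n, ℂ) →ₗ[ℂ] 𝓢'(Rn n, ℂ)} (h : HasBoundedExtension η p q H) :
    IsBoundedOnModulation η p q H := by
  obtain ⟨T, hT, C, hC⟩ := h
  -- The constant must be nonzero, so that the right-hand side is `⊤` when the norm of f is;
  -- finiteness of that norm for Schwartz f is then not needed.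
  refine ⟨C + 1, fun f => ?_⟩
  by_cases hf : MemModulation η p q (toTemperedDistributionCLM (Rn n) ℂ volume f)
  · rw [← hT]
    refine (hC _ hf).trans ?_
    gcongr
    exact le_self_add
  · rw [MemModulation, not_lt, top_le_iff] at hf
    rw [hf, ENNReal.mul_top (by simp)]
    exact le_top

theorem isBoundedOnModulation_zero {n : ℕ} (η : Rn n → ℝ) (p : ℝ≥0∞) {q : ℝ≥0∞} (hq : 0 < q) :
    IsBoundedOnModulation η p q (0 : 𝓢(Rn n, ℂ) →ₗ[ℂ] 𝓢'(Rn n, ℂ)) :=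
  ⟨0, fun f => by simp [modulationNorm_zero η p hq]⟩

theorem hasBoundedExtension_zero {n : ℕ} (η : Rn n → ℝ) (p : ℝ≥0∞) {q : ℝ≥0∞} (hq : 0 < q) :
    HasBoundedExtension η p q (0 : 𝓢(Rn n, ℂ) →ₗ[ℂ] 𝓢'(Rn n, ℂ)) :=
  ⟨0, fun f => by simp, 0, fun u _ => by simp [modulationNorm_zero η p hq]⟩

end HausdorffModulation

end

theorem mainTheorem5 {n : ℕ} [NeZero n] (p q : ℝ≥0∞) (hp : 0 < p) (hq : 0 < q)
    (hpq : p < 1 ∨ q < 1)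
    (η : HausdorffModulation.Rn n → ℝ) (hη : HausdorffModulation.IsWindow η)
    (Φ : HausdorffModulation.Rn n → ℂ) (hΦ : HausdorffModulation.IsHausdorffKernel Φ) :
    (HausdorffModulation.IsBoundedOnModulation η p q (HausdorffModulation.hausdorffOp hΦ) ↔
      HausdorffModulation.hausdorffOp hΦ = 0) ∧
    (HausdorffModulation.HasBoundedExtension η p q (HausdorffModulation.hausdorffOp hΦ) ↔
      HausdorffModulation.hausdorffOp hΦ = 0) := by
  have hmain : HausdorffModulation.IsBoundedOnModulation η p q
      (HausdorffModulation.hausdorffOp hΦ) → HausdorffModulation.hausdorffOp hΦ = 0 := by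
    intro hb
    -- The argument for p < 1 works for every q > 0; the other one needs p ≥ 1 for Hölder's
    -- inequality.
    by_cases hp1 : p < 1
    · exact hΦ.eq_zero_of_isBounded_of_lt_one_left hη hp hp1 hq hb
    · exact hΦ.eq_zero_of_isBounded_of_lt_one_right hη (not_lt.1 hp1) hq
        (hpq.resolve_left hp1) hb
  refine ⟨⟨hmain, fun h => ?_⟩, fun h => hmain h.isBoundedOnModulation, fun h => ?_⟩
  · rw [h]
    exact HausdorffModulation.isBoundedOnModulation_zero η p hq
  · rw [h]
    exact HausdorffModulation.hasBoundedExtension_zero η p hq
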